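/- Let $\omega_0,\epsilon_F>0$ be fixed. Put $f_0(x)=1/(e^x+1)$, $n_0(x)=1/(e^x-1)$, and for $T>0$ $$w(\epsilon)=f_0(\epsilon/T)\,[1-f_0(\epsilon/T)],\qquad \bar k_0(x,y)=[n_0(y)+f_0(x+y)]\,y^2\,\mathrm{sgn}(y),$$ $$\bar K_0(\epsilon,u)=\Big(\frac{T}{\omega_0}\Big)^2\bar k_0\Big(\frac{\epsilon}{T},\frac{u-\epsilon}{T}\Big),\quad \bar K_1(\epsilon,u)=\frac{u-\epsilon}{2\epsilon_F}\,\bar K_0(\epsilon,u),\quad \bar K_2(\epsilon,u)=\frac12\Big(\frac{u-\epsilon}{\omega_0}\Big)^2\bar K_0(\epsilon,u),$$ $\Gamma_\nu(\epsilon)=\int_{\mathbb R}\bar K_\nu(\epsilon,u)\,du$ and $K_\nu(\epsilon,u)=\bar K_\nu(\epsilon,u)/\Gamma_0(\epsilon)$ for $\nu=0,1,2$, and $K=K_0+K_1-K_2$. Let $d\sigma=w\,\Gamma_0\,d\epsilon$. Write $K_0$ also for the integral operator $(K_0g)(\epsilon)=\int_{\mathbb R}K_0(\epsilon,u)g(u)\,du$,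 and $\langle g\rangle_w=\int_{\mathbb R} g\,w\,d\epsilon\big/\int_{\mathbb R} w\,d\epsilon$. **Theorem.** (a) For every $T>0$ all integrals in these definitions and in the expression below converge, $\Gamma_0>0$, the series converges, and the rate $$\frac1{\phi_+(T)}=\langle\Gamma_2\rangle_w+\sum_{m=0}^\infty\big\langle\Gamma_1\,(K_0)^m(\Gamma_1/\Gamma_0)\big\rangle_w$$ is positive. (b) There is $T_0>0$ such that for $0<T<T_0$ the electron–phonon Boltzmann integral equation $$\varphi(\epsilon)=\frac1{\Gamma_0(\epsilon)}+\int_{\mathbb R}K(\epsilon,u)\,\varphi(u)\,du\qquad\text{for a.e. }\epsilon\in\mathbb R$$ has a solution $\varphi=\varphi_T\in L^2(\mathbb R,d\sigma)$, unique up to equality almost everywhere, and $w\varphi_T$ is integrable. The transport relaxation time $\tau(T)=\frac1{2T}\int_{\mathbb R}w(\epsilon)\,\varphi_T(\epsilon)\,d\epsilon$ is thus well defined. (c) There is a constant $C>0$, depending only on $\omega_0$ and $\epsilon_F$, such that $\phi_+(T)=C\,T^{-5}$ for all $T>0$; and, as $T\to0^+$, $\tau(T)\sim\phi_+(T)/2$,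 that is, $\tau(T)/(\phi_+(T)/2)\to1$. In particular Bloch's law holds: $T^5\,\tau(T)\to C/2$. -/

import Mathlib

open MeasureTheory Filter Topology Asymptotics

noncomputable section

namespace Bloch

/-- Fermi distribution function. -/
def f₀ (x : ℝ) : ℝ := 1 / (Real.exp x + 1)

/-- Bose distribution function. -/
def n₀ (x : ℝ) : ℝ := 1 / (Real.exp x - 1)

/-- Weight function `w(ε) = f₀(ε/T) (1 - f₀(ε/T))` at temperature `T`. -/
def w (T ε : ℝ) : ℝ := f₀ (ε / T) * (1 - f₀ (ε / T))

/-- Dimensionless basic kernel `k̄₀(x,y) = [n₀(y) + f₀(y+x)] y² sgn y`. -/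
def kbar₀ (x y : ℝ) : ℝ := (n₀ y + f₀ (y + x)) * y ^ 2 * Real.sign y

/-- `K̄₀(ε,u) = (T/ω₀)² k̄₀(ε/T, (u-ε)/T)`. -/
def Kbar₀ (ω₀ T ε u : ℝ) : ℝ := (T / ω₀) ^ 2 * kbar₀ (ε / T) ((u - ε) / T)

/-- `K̄₁(ε,u) = (ω₀/2ε_F) (T/ω₀) ((u-ε)/T) K̄₀(ε,u)`. -/
def Kbar₁ (ω₀ εF T ε u : ℝ) : ℝ :=
  ω₀ / (2 * εF) * (T / ω₀) * ((u - ε) / T) * Kbar₀ ω₀ T ε u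

/-- `K̄₂(ε,u) = ½ (T/ω₀)² ((u-ε)/T)² K̄₀(ε,u)`. -/
def Kbar₂ (ω₀ T ε u : ℝ) : ℝ :=
  1 / 2 * (T / ω₀) ^ 2 * ((u - ε) / T) ^ 2 * Kbar₀ ω₀ T ε u

/-- Single-particle relaxation rate `Γ₀(ε) = ∫ K̄₀(ε,u) du`. -/
def Γ₀ (ω₀ T ε : ℝ) : ℝ := ∫ u, Kbar₀ ω₀ T ε u

/-- `Γ₁(ε) = ∫ K̄₁(ε,u) du`. -/
def Γ₁ (ω₀ εF T ε : ℝ) : ℝ := ∫ u, Kbar₁ ω₀ εF T ε u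

/-- `Γ₂(ε) = ∫ K̄₂(ε,u) du`. -/
def Γ₂ (ω₀ T ε : ℝ) : ℝ := ∫ u, Kbar₂ ω₀ T ε u

/-- `K₀(ε,u) = K̄₀(ε,u) / Γ₀(ε)`. -/
def K₀ (ω₀ T ε u : ℝ) : ℝ := Kbar₀ ω₀ T ε u / Γ₀ ω₀ T ε

/-- `K₁(ε,u) = K̄₁(ε,u) / Γ₀(ε)`. -/
def K₁ (ω₀ εF T ε u : ℝ) : ℝ := Kbar₁ ω₀ εF T ε u / Γ₀ ω₀ T ε

/-- `K₂(ε,u) = K̄₂(ε,u) / Γ₀(ε)`. -/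
def K₂ (ω₀ T ε u : ℝ) : ℝ := Kbar₂ ω₀ T ε u / Γ₀ ω₀ T ε

/-- Full kernel `K = K₀ + K₁ - K₂`. -/
def K (ω₀ εF T ε u : ℝ) : ℝ := K₀ ω₀ T ε u + K₁ ω₀ εF T ε u - K₂ ω₀ T ε u

/-- The measure `dσ(ε) = w(ε) Γ₀(ε) dε`. -/
def sigmaMeasure (ω₀ T : ℝ) : Measure ℝ :=
  volume.withDensity fun ε => ENNReal.ofReal (w T ε * Γ₀ ω₀ T ε)

/-- `φ` is a solution in `L²(σ)` of the integral equation
`φ(ε) = 1/Γ₀(ε) + ∫ K(ε,u) φ(u) du`. -/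
structure IsSolution (ω₀ εF T : ℝ) (φ : ℝ → ℝ) : Prop where
  memLp : MemLp φ 2 (sigmaMeasure ω₀ T)
  eqn : ∀ᵐ ε, Integrable (fun u => K ω₀ εF T ε u * φ u) ∧
    φ ε = 1 / Γ₀ ω₀ T ε + ∫ u, K ω₀ εF T ε u * φ u

/-- Transport relaxation time `(1/2T) ∫ w(ε) φ(ε) dε` belonging to an inverse rate `φ`. -/
def relaxationTime (T : ℝ) (φ : ℝ → ℝ) : ℝ := 1 / (2 * T) * ∫ ε, w T ε * φ ε

/-- Average `⟨g⟩_w = ∫ g w dε / ∫ w dε`. -/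
def avg (T : ℝ) (g : ℝ → ℝ) : ℝ := (∫ ε, g ε * w T ε) / ∫ ε, w T ε

/-- The integral operator with kernel `K₀`. -/
def K₀op (ω₀ T : ℝ) (g : ℝ → ℝ) : ℝ → ℝ := fun ε => ∫ u, K₀ ω₀ T ε u * g u

/-- The function `(K₀)^m (Γ₁/Γ₀)`. -/
def iter (ω₀ εF T : ℝ) (m : ℕ) : ℝ → ℝ :=
  (K₀op ω₀ T)^[m] fun ε => Γ₁ ω₀ εF T ε / Γ₀ ω₀ T ε

/-- The function `Γ₁ (K₀)^m (Γ₁/Γ₀)`. -/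
def term (ω₀ εF T : ℝ) (m : ℕ) : ℝ → ℝ := fun ε => Γ₁ ω₀ εF T ε * iter ω₀ εF T m ε

/-- The rate `1/φ₊ = ⟨Γ₂⟩_w + ∑ₘ ⟨Γ₁ (K₀)^m Γ₁/Γ₀⟩_w`. -/
def rate (ω₀ εF T : ℝ) : ℝ :=
  avg T (Γ₂ ω₀ T) + ∑' m : ℕ, avg T (term ω₀ εF T m)

/-- `φ₊`. -/
def phiPlus (ω₀ εF T : ℝ) : ℝ := 1 / rate ω₀ εF T

end Bloch

end

/-!
Conjugating with the square root of the density of `dσ` and rescaling the energy by `T` turns the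
equation into `(1 - M₀ - T M₁ + T² M₂) F = b` on `L²(ℝ)`, with `M₀`, `M₁`, `M₂` and `b`
independent of `T`; this scaling is the source of the exact power law for `φ₊`.

The kernel of `M₀` is positive and symmetric and `M₀` fixes the positive function `e`, the image of
the constant function `1`. By the ground state representation `‖F‖² - ‖M₀ F‖²` is a sum of local
variances; they give a Poincaré inequality on bounded sets, and outside a bounded set a Schur test
makes the kernel small. So `1` is a simple isolated eigenvalue of `M₀`.

Since `M₁` is skew, the energy `⟪F, (1 - M₀ - T M₁ + T² M₂) F⟫` does not see it, and the operator is
coercive for small `T > 0`. Testing the equation against `e - T (1 - M₀)⁻¹ M₁ e` removes the first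
order and yields `T² ⟪b, F⟫ → 1 / κ`, where `κ` is the second-order coefficient
`⟪e, M₂ e⟫ + ⟪M₁ e, (1 - M₀)⁻¹ M₁ e⟫`, whose Neumann series is the series in the rate.
-/

open scoped RealInnerProductSpace

section SpectralGap

variable {H : Type*} [NormedAddCommGroup H] [InnerProductSpace ℝ H]
  {M M₀ M₁ M₂ : H →L[ℝ] H} {e g b : H} {q : ℝ}

/-- The symmetric operator `M` fixes `e` and contracts the orthogonal complement of `e` by the
factor `q < 1`, so `1` is an isolated simple eigenvalue of `M` with eigenvector `e`. -/
structure HasSpectralGap (M : H →L[ℝ] H) (e : H) (q : ℝ) : Prop where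
  symm : (M : H →ₗ[ℝ] H).IsSymmetric
  fixed : M e = e
  nonneg : 0 ≤ q
  lt_one : q < 1
  norm_le : ∀ x, ⟪e, x⟫ = 0 → ‖M x‖ ≤ q * ‖x‖

namespace HasSpectralGap

lemma inner_map (h : HasSpectralGap M e q) (x : H) : ⟪e, M x⟫ = ⟪e, x⟫ := by
  simpa only [ContinuousLinearMap.coe_coe, h.fixed] using (h.symm e x).symm

lemma le_inner_sub_map (h : HasSpectralGap M e q) {x : H} (hx : ⟪e, x⟫ = 0) :
    (1 - q) * ‖x‖ ^ 2 ≤ ⟪x - M x, x⟫ := by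
  have hM : ⟪M x, x⟫ ≤ q * ‖x‖ * ‖x‖ :=
    (real_inner_le_norm _ _).trans (by gcongr; exact h.norm_le x hx)
  rw [inner_sub_left, real_inner_self_eq_norm_sq]
  linarith

lemma inner_pow (h : HasSpectralGap M e q) (hg : ⟪e, g⟫ = 0) (m : ℕ) : ⟪e, (M ^ m) g⟫ = 0 := by
  induction m with
  | zero => simpa using hg
  | succ m ih => rw [pow_succ', mul_apply_eq_comp, h.inner_map, ih]

lemma norm_pow_le (h : HasSpectralGap M e q) (hg : ⟪e, g⟫ = 0) (m : ℕ) :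
    ‖(M ^ m) g‖ ≤ ‖g‖ * q ^ m := by
  induction m with
  | zero => simp
  | succ m ih =>
    calc ‖(M ^ (m + 1)) g‖ = ‖M ((M ^ m) g)‖ := by rw [pow_succ', mul_apply_eq_comp]
      _ ≤ q * ‖(M ^ m) g‖ := h.norm_le _ (h.inner_pow hg m)
      _ ≤ q * (‖g‖ * q ^ m) := mul_le_mul_of_nonneg_left ih h.nonneg
      _ = ‖g‖ * q ^ (m + 1) := by ring

lemma summable_pow [CompleteSpace H] (h : HasSpectralGap M e q) (hg : ⟪e, g⟫ = 0) :
    Summable fun m : ℕ => (M ^ m) g :=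
  .of_norm_bounded ((summable_geometric_of_lt_one h.nonneg h.lt_one).mul_left _)
    (h.norm_pow_le hg)

lemma tsum_sub_map_tsum [CompleteSpace H] (h : HasSpectralGap M e q) (hg : ⟪e, g⟫ = 0) :
    ∑' m : ℕ, (M ^ m) g - M (∑' m : ℕ, (M ^ m) g) = g := by
  have hs := h.summable_pow hg
  have hshift : M (∑' m : ℕ, (M ^ m) g) = ∑' m : ℕ, (M ^ (m + 1)) g := by
    simp only [M.map_tsum hs, pow_succ', mul_apply_eq_comp]
  rw [hshift, hs.tsum_eq_zero_add, pow_zero, one_apply_eq_self, add_sub_cancel_right]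

lemma hasSum_inner_pow [CompleteSpace H] (h : HasSpectralGap M e q) (hg : ⟪e, g⟫ = 0) (x : H) :
    HasSum (fun m : ℕ => ⟪x, (M ^ m) g⟫) ⟪x, ∑' m : ℕ, (M ^ m) g⟫ :=
  (h.summable_pow hg).hasSum.mapL (innerSL ℝ x)

lemma inner_tsum_nonneg [CompleteSpace H] (h : HasSpectralGap M e q) (hg : ⟪e, g⟫ = 0) :
    0 ≤ ⟪g, ∑' m : ℕ, (M ^ m) g⟫ := by
  have horth : ⟪e, ∑' m : ℕ, (M ^ m) g⟫ = 0 := by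
    rw [← (h.hasSum_inner_pow hg e).tsum_eq]
    simp only [h.inner_pow hg, tsum_zero]
  have hgap := h.le_inner_sub_map horth
  rw [h.tsum_sub_map_tsum hg] at hgap
  exact (mul_nonneg (sub_nonneg.2 h.lt_one.le) (sq_nonneg _)).trans hgap

end HasSpectralGap

lemma norm_sq_sub_norm_map_sq_sub_smul (hM : (M : H →ₗ[ℝ] H).IsSymmetric) (he : M e = e) (x : H)
    (m : ℝ) : ‖x - m • e‖ ^ 2 - ‖M (x - m • e)‖ ^ 2 = ‖x‖ ^ 2 - ‖M x‖ ^ 2 := by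
  have hinner : ⟪M x, e⟫ = ⟪x, e⟫ := by
    simpa only [ContinuousLinearMap.coe_coe, he] using hM x e
  rw [map_sub, map_smul, he, norm_sub_sq_real, norm_sub_sq_real, real_inner_smul_right,
    real_inner_smul_right, hinner]
  ring

-- Poincaré inequality on a set plus a tail bound off that set: `y` and `z` play the roles of the
-- two restrictions of `x - m e`.
theorem exists_hasSpectralGap (hM : (M : H →ₗ[ℝ] H).IsSymmetric) (he : M e = e)
    (hnorm : ∀ x, ‖M x‖ ≤ ‖x‖) {c : ℝ} (hc : 0 < c)
    (hsplit : ∀ x, ∃ (m : ℝ) (y z : H), x - m • e = y + z ∧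
      c * ‖y‖ ^ 2 ≤ ‖x‖ ^ 2 - ‖M x‖ ^ 2 ∧ ‖M z‖ ≤ 1 / 2 * ‖x - m • e‖) :
    ∃ q, HasSpectralGap M e q := by
  set K := 2 + 4 / c with hK
  have hK1 : 1 < K := by linarith [div_pos four_pos hc]
  have hq : 0 ≤ 1 - 1 / K := sub_nonneg.2 ((div_le_one (by linarith)).2 hK1.le)
  have hq1 : √(1 - 1 / K) < 1 := by
    rw [Real.sqrt_lt' one_pos, one_pow, sub_lt_self_iff]
    positivity
  refine ⟨√(1 - 1 / K), hM, he, Real.sqrt_nonneg _, hq1, fun x hx => ?_⟩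
  obtain ⟨m, y, z, hyz, hy, hz⟩ := hsplit x
  have hdefect := norm_sq_sub_norm_map_sq_sub_smul hM he x m
  set x' := x - m • e
  have hx' : ‖x‖ ^ 2 ≤ ‖x'‖ ^ 2 := by
    rw [norm_sub_sq_real, real_inner_smul_right, real_inner_comm, hx]
    linarith [sq_nonneg ‖m • e‖]
  have hMx' : ‖M x'‖ ≤ ‖y‖ + 1 / 2 * ‖x'‖ := by
    rw [hyz, map_add]
    exact (norm_add_le _ _).trans (add_le_add (hnorm y) (hyz ▸ hz))
  have hMx'_sq : ‖M x'‖ ^ 2 ≤ 2 * ‖y‖ ^ 2 + 1 / 2 * ‖x'‖ ^ 2 := by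
    nlinarith [pow_le_pow_left₀ (norm_nonneg _) hMx' 2, sq_nonneg (‖y‖ - 1 / 2 * ‖x'‖)]
  have hy' : ‖y‖ ^ 2 ≤ (‖x‖ ^ 2 - ‖M x‖ ^ 2) / c := (le_div_iff₀' hc).2 hy
  have hgap : ‖x‖ ^ 2 / K ≤ ‖x‖ ^ 2 - ‖M x‖ ^ 2 := by
    rw [div_le_iff₀' (by linarith), hK, add_mul, div_mul_eq_mul_div, mul_div_assoc]
    linarith
  refine le_of_sq_le_sq ?_ (by positivity)
  rw [mul_pow, Real.sq_sqrt hq]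
  linear_combination hgap

lemma exists_eq_smul_add_of_ne_zero (he : e ≠ 0) (x : H) :
    ∃ (α : ℝ) (ψ : H), ⟪e, ψ⟫ = 0 ∧ x = α • e + ψ := by
  refine ⟨⟪e, x⟫ / ‖e‖ ^ 2, x - (⟪e, x⟫ / ‖e‖ ^ 2) • e, ?_, by abel⟩
  rw [inner_sub_right, real_inner_smul_right, real_inner_self_eq_norm_sq,
    div_mul_cancel₀ _ (by simpa using he), sub_self]

/-- The operator `1 - M₀ - t M₁ + t² M₂`. -/
noncomputable def perturbedOp (M₀ M₁ M₂ : H →L[ℝ] H) (t : ℝ) : H →L[ℝ] H :=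
  1 - M₀ - t • M₁ + t ^ 2 • M₂

lemma perturbedOp_apply (M₀ M₁ M₂ : H →L[ℝ] H) (t : ℝ) (x : H) :
    perturbedOp M₀ M₁ M₂ t x = x - M₀ x - t • M₁ x + t ^ 2 • M₂ x := by
  simp [perturbedOp]

/-- The coefficient `κ` for which the solutions of `perturbedOp M₀ M₁ M₂ t x = b` blow up like
`(κ t²)⁻¹` along `e`: second order perturbation theory of the eigenvalue `0` of `1 - M₀`, with the
inverse of `1 - M₀` written as a Neumann series. -/
noncomputable def secondOrderRate (M₀ M₁ M₂ : H →L[ℝ] H) (e : H) : ℝ :=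
  ⟪e, M₂ e⟫ + ∑' m : ℕ, ⟪M₁ e, (M₀ ^ m) (M₁ e)⟫

/-- The data of a singular perturbation problem `1 - M₀ - t M₁ + t² M₂`: the kernel of `1 - M₀` is
spanned by `e` and isolated by a gap, the first-order term is skew, and the second-order term is
symmetric and positive on `e`. -/
structure IsGappedPerturbation (M₀ M₁ M₂ : H →L[ℝ] H) (e : H) (q : ℝ) : Prop
    extends HasSpectralGap M₀ e q where
  skew : ∀ x y, ⟪M₁ x, y⟫ = -⟪x, M₁ y⟫
  symm₂ : (M₂ : H →ₗ[ℝ] H).IsSymmetric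
  pos : 0 < ⟪e, M₂ e⟫

lemma exists_le_inner_map_smul_add {S : H →L[ℝ] H} (hS : (S : H →ₗ[ℝ] H).IsSymmetric)
    (he : 0 < ⟪e, S e⟫) :
    ∃ D, ∀ (α : ℝ) (ψ : H),
      ⟪e, S e⟫ / 2 * α ^ 2 - D * ‖ψ‖ ^ 2 ≤ ⟪S (α • e + ψ), α • e + ψ⟫ := by
  set β := ⟪e, S e⟫
  refine ⟨2 * ‖S e‖ ^ 2 / β + ‖S‖, fun α ψ => ?_⟩
  have hexpand : ⟪S (α • e + ψ), α • e + ψ⟫ = α ^ 2 * β + 2 * α * ⟪S e, ψ⟫ + ⟪S ψ, ψ⟫ := by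
    have hψ : ⟪S ψ, e⟫ = ⟪S e, ψ⟫ := by rw [real_inner_comm]; exact (hS e ψ).symm
    have he : ⟪S e, e⟫ = β := real_inner_comm _ _
    simp only [map_add, map_smul, inner_add_left, inner_add_right, real_inner_smul_left,
      real_inner_smul_right, hψ, he]
    ring
  have hsquare : 0 ≤ α ^ 2 * β / 2 + 2 * α * ⟪S e, ψ⟫ + 2 * ⟪S e, ψ⟫ ^ 2 / β := by
    have : α ^ 2 * β / 2 + 2 * α * ⟪S e, ψ⟫ + 2 * ⟪S e, ψ⟫ ^ 2 / β =
        (α * β + 2 * ⟪S e, ψ⟫) ^ 2 / (2 * β) := by field_simp; ring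
    rw [this]; positivity
  have hcross : 2 * ⟪S e, ψ⟫ ^ 2 / β ≤ 2 * ‖S e‖ ^ 2 / β * ‖ψ‖ ^ 2 := by
    rw [div_mul_eq_mul_div, mul_assoc, ← mul_pow]
    gcongr 2 * ?_ / β
    exact sq_le_sq' (neg_le_of_abs_le (abs_real_inner_le_norm _ _)) (real_inner_le_norm _ _)
  have hdiag : -(‖S‖ * ‖ψ‖ ^ 2) ≤ ⟪S ψ, ψ⟫ := by
    refine neg_le_of_abs_le ((abs_real_inner_le_norm _ _).trans ?_)
    rw [sq, ← mul_assoc]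
    gcongr
    exact S.le_opNorm ψ
  rw [hexpand]
  linarith

namespace IsGappedPerturbation

lemma ne_zero (h : IsGappedPerturbation M₀ M₁ M₂ e q) : e ≠ 0 := by
  rintro rfl
  simpa using h.pos

lemma inner_map_self (h : IsGappedPerturbation M₀ M₁ M₂ e q) (x : H) : ⟪M₁ x, x⟫ = 0 := by
  have := h.skew x x
  rw [real_inner_comm (M₁ x) x] at this
  linarith

lemma inner_skew_fixed (h : IsGappedPerturbation M₀ M₁ M₂ e q) : ⟪e, M₁ e⟫ = 0 := by
  rw [real_inner_comm, h.inner_map_self]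

lemma inner_perturbedOp_self (h : IsGappedPerturbation M₀ M₁ M₂ e q) (t α : ℝ) (ψ : H) :
    ⟪perturbedOp M₀ M₁ M₂ t (α • e + ψ), α • e + ψ⟫ =
      ⟪ψ - M₀ ψ, ψ⟫ + t ^ 2 * ⟪M₂ (α • e + ψ), α • e + ψ⟫ := by
  have hfix : α • e + ψ - M₀ (α • e + ψ) = ψ - M₀ ψ := by
    rw [map_add, map_smul, h.fixed]; abel
  have horth : ⟪ψ - M₀ ψ, e⟫ = 0 := by
    rw [real_inner_comm, inner_sub_right, h.inner_map, sub_self]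
  rw [perturbedOp_apply, hfix, inner_add_left, inner_sub_left, real_inner_smul_left,
    real_inner_smul_left, h.inner_map_self, inner_add_right _ (α • e) ψ, real_inner_smul_right,
    horth]
  ring

lemma energy_estimate (h : IsGappedPerturbation M₀ M₁ M₂ e q) :
    ∃ c > 0, ∀ᶠ t in 𝓝 (0 : ℝ), ∀ (α : ℝ) (ψ : H), ⟪e, ψ⟫ = 0 →
      c * (‖ψ‖ ^ 2 + t ^ 2 * α ^ 2) ≤ ⟪perturbedOp M₀ M₁ M₂ t (α • e + ψ), α • e + ψ⟫ := by
  obtain ⟨D, hD⟩ := exists_le_inner_map_smul_add h.symm₂ h.pos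
  have hq : 0 < (1 - q) / 2 := half_pos (sub_pos.2 h.lt_one)
  have hsmall : ∀ᶠ t in 𝓝 (0 : ℝ), t ^ 2 * D ≤ (1 - q) / 2 :=
    ((by fun_prop : Continuous fun t : ℝ => t ^ 2 * D).tendsto' 0 0
      (by simp)).eventually_le_const hq
  have hβ := half_pos h.pos
  refine ⟨min ((1 - q) / 2) (⟪e, M₂ e⟫ / 2), lt_min hq hβ, ?_⟩
  filter_upwards [hsmall] with t ht α ψ hψ
  set c := min ((1 - q) / 2) (⟪e, M₂ e⟫ / 2)
  have hcψ : c * ‖ψ‖ ^ 2 ≤ (1 - q) / 2 * ‖ψ‖ ^ 2 := by gcongr; exact min_le_left _ _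
  have hcα : c * (t ^ 2 * α ^ 2) ≤ ⟪e, M₂ e⟫ / 2 * (t ^ 2 * α ^ 2) := by
    gcongr; exact min_le_right _ _
  have hgap := h.le_inner_sub_map hψ
  have hsecond := mul_le_mul_of_nonneg_left (hD α ψ) (sq_nonneg t)
  have hDψ := mul_le_mul_of_nonneg_right ht (sq_nonneg ‖ψ‖)
  rw [h.inner_perturbedOp_self]
  linarith

lemma eventually_isCoercive (h : IsGappedPerturbation M₀ M₁ M₂ e q) :
    ∀ᶠ t in 𝓝[≠] (0 : ℝ), IsCoercive ((innerSL ℝ).comp (perturbedOp M₀ M₁ M₂ t)) := by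
  obtain ⟨c, hc, henergy⟩ := h.energy_estimate
  filter_upwards [henergy.filter_mono nhdsWithin_le_nhds, self_mem_nhdsWithin] with t ht ht0
  have he : 0 < ‖e‖ := norm_pos_iff.2 h.ne_zero
  have ht2 : 0 < t ^ 2 := sq_pos_of_ne_zero ht0
  refine ⟨c * min 1 (t ^ 2 / ‖e‖ ^ 2), by positivity, fun x => ?_⟩
  obtain ⟨α, ψ, hψ, rfl⟩ := exists_eq_smul_add_of_ne_zero h.ne_zero x
  have hnorm : ‖α • e + ψ‖ * ‖α • e + ψ‖ = α ^ 2 * ‖e‖ ^ 2 + ‖ψ‖ ^ 2 := by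
    rw [norm_add_sq_eq_norm_sq_add_norm_sq_real (by rw [real_inner_smul_left, hψ, mul_zero]),
      norm_smul, mul_mul_mul_comm, Real.norm_eq_abs, abs_mul_abs_self]
    ring
  calc c * min 1 (t ^ 2 / ‖e‖ ^ 2) * ‖α • e + ψ‖ * ‖α • e + ψ‖
      = c * (min 1 (t ^ 2 / ‖e‖ ^ 2) * ‖ψ‖ ^ 2 +
          min 1 (t ^ 2 / ‖e‖ ^ 2) * (α ^ 2 * ‖e‖ ^ 2)) := by rw [mul_assoc, hnorm]; ring
    _ ≤ c * (1 * ‖ψ‖ ^ 2 + t ^ 2 / ‖e‖ ^ 2 * (α ^ 2 * ‖e‖ ^ 2)) := by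
        gcongr
        exacts [min_le_left _ _, min_le_right _ _]
    _ = c * (‖ψ‖ ^ 2 + t ^ 2 * α ^ 2) := by field_simp
    _ ≤ ⟪perturbedOp M₀ M₁ M₂ t (α • e + ψ), α • e + ψ⟫ := ht α ψ hψ

theorem eventually_bijective [CompleteSpace H] (h : IsGappedPerturbation M₀ M₁ M₂ e q) :
    ∀ᶠ t in 𝓝[≠] (0 : ℝ), Function.Bijective (perturbedOp M₀ M₁ M₂ t) := by
  filter_upwards [h.eventually_isCoercive] with t ht
  have heq : ⇑(perturbedOp M₀ M₁ M₂ t) = ht.continuousLinearEquivOfBilin :=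
    funext fun x => ht.unique_continuousLinearEquivOfBilin fun y => by simp
  rw [heq]
  exact ht.continuousLinearEquivOfBilin.bijective

lemma exists_secondOrder_eq [CompleteSpace H] (h : IsGappedPerturbation M₀ M₁ M₂ e q) :
    ∃ v, v - M₀ v = M₁ e ∧ secondOrderRate M₀ M₁ M₂ e = ⟪e, M₂ e⟫ + ⟪M₁ e, v⟫ :=
  ⟨_, h.tsum_sub_map_tsum h.inner_skew_fixed,
    congrArg _ (h.hasSum_inner_pow h.inner_skew_fixed _).tsum_eq⟩

theorem secondOrderRate_pos [CompleteSpace H] (h : IsGappedPerturbation M₀ M₁ M₂ e q) :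
    0 < secondOrderRate M₀ M₁ M₂ e := by
  have := h.inner_tsum_nonneg h.inner_skew_fixed
  rw [← (h.hasSum_inner_pow h.inner_skew_fixed _).tsum_eq] at this
  exact add_pos_of_pos_of_nonneg h.pos this

-- The adjoint operator maps the corrected eigenvector `e - t v` to something of order `t²`.
lemma inner_perturbedOp_corrector (h : IsGappedPerturbation M₀ M₁ M₂ e q) {v : H}
    (hv : v - M₀ v = M₁ e) (t : ℝ) (x : H) :
    ⟪perturbedOp M₀ M₁ M₂ t x, e - t • v⟫ = t ^ 2 * ⟪x, M₂ e - M₁ v - t • M₂ v⟫ := by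
  have h₀ : ∀ y, ⟪M₀ x, y⟫ = ⟪x, M₀ y⟫ := fun y => h.symm x y
  have h₂ : ∀ y, ⟪M₂ x, y⟫ = ⟪x, M₂ y⟫ := fun y => h.symm₂ x y
  rw [perturbedOp_apply]
  simp only [inner_add_left, inner_sub_left, inner_sub_right, real_inner_smul_left,
    real_inner_smul_right, h₀, h₂, h.skew, h.fixed, ← hv, map_smul]
  ring

-- Solutions may be of size `t⁻²` along `e`, but only of size `t⁻¹` across `e`.
lemma a_priori_bound (h : IsGappedPerturbation M₀ M₁ M₂ e q) (hb : ⟪e, b⟫ = 1) :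
    ∃ k, ∀ᶠ t in 𝓝 (0 : ℝ), ∀ (α : ℝ) (ψ : H), ⟪e, ψ⟫ = 0 →
      perturbedOp M₀ M₁ M₂ t (α • e + ψ) = b → ‖t • ψ‖ ≤ k ∧ |t ^ 2 * α| ≤ k := by
  obtain ⟨c, hc, henergy⟩ := h.energy_estimate
  have hlt : ∀ᶠ t in 𝓝 (0 : ℝ), |t| ≤ 1 :=
    (continuous_abs.tendsto' (0 : ℝ) 0 abs_zero).eventually_le_const one_pos
  refine ⟨(1 + ‖b‖) / c, ?_⟩
  filter_upwards [henergy, hlt] with t ht ht1 α ψ hψ hx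
  have hbx : ⟪b, α • e + ψ⟫ = α + ⟪b, ψ⟫ := by
    rw [inner_add_right, real_inner_smul_right, real_inner_comm, hb, mul_one]
  have hscaled : c * (‖t • ψ‖ ^ 2 + (t ^ 2 * α) ^ 2) ≤ t ^ 2 * α + t * ⟪b, t • ψ⟫ := by
    have := mul_le_mul_of_nonneg_left (ht α ψ hψ) (sq_nonneg t)
    rw [hx, hbx] at this
    rw [norm_smul, mul_pow, Real.norm_eq_abs, sq_abs, real_inner_smul_right]
    linarith
  have hinner : t * ⟪b, t • ψ⟫ ≤ ‖b‖ * ‖t • ψ‖ :=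
    calc t * ⟪b, t • ψ⟫ ≤ |t| * |⟪b, t • ψ⟫| := (le_abs_self _).trans (abs_mul _ _).le
      _ ≤ 1 * (‖b‖ * ‖t • ψ‖) := by gcongr; exact abs_real_inner_le_norm _ _
      _ = ‖b‖ * ‖t • ψ‖ := one_mul _
  set X := ‖t • ψ‖
  set Y := t ^ 2 * α
  have hsq : (c * X) ^ 2 + (c * Y) ^ 2 ≤ (1 + ‖b‖) ^ 2 := by
    nlinarith [sq_nonneg (c * Y - 1), sq_nonneg (c * X - ‖b‖), norm_nonneg b,
      mul_le_mul_of_nonneg_left (hscaled.trans (add_le_add_right hinner Y)) hc.le]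
  have hB : 0 ≤ 1 + ‖b‖ := by positivity
  rw [le_div_iff₀' hc, le_div_iff₀' hc, ← abs_of_pos hc, ← abs_mul, abs_of_pos hc]
  exact ⟨le_of_sq_le_sq (by nlinarith [sq_nonneg (c * Y)]) hB,
    abs_le_of_sq_le_sq (by nlinarith [sq_nonneg (c * X)]) hB⟩

theorem exists_abs_sq_mul_inner_sub_le [CompleteSpace H]
    (h : IsGappedPerturbation M₀ M₁ M₂ e q) (hb : ⟪e, b⟫ = 1) :
    ∃ C, ∀ᶠ t in 𝓝 (0 : ℝ), ∀ x, perturbedOp M₀ M₁ M₂ t x = b →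
      |secondOrderRate M₀ M₁ M₂ e * (t ^ 2 * ⟪b, x⟫) - 1| ≤ |t| * C := by
  obtain ⟨v, hv, hκ⟩ := h.exists_secondOrder_eq
  obtain ⟨k, hk⟩ := h.a_priori_bound hb
  set κ := secondOrderRate M₀ M₁ M₂ e
  set r := M₂ e - M₁ v
  have her : ⟪e, r⟫ = κ := by
    rw [inner_sub_right, hκ, h.skew, sub_eq_add_neg]
  refine ⟨‖b‖ * ‖v‖ + k * (|κ| * ‖b‖ + ‖r‖ + ‖M₂ v‖ + |⟪e, M₂ v⟫|), ?_⟩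
  have hlt : ∀ᶠ t in 𝓝 (0 : ℝ), |t| ≤ 1 :=
    (continuous_abs.tendsto' (0 : ℝ) 0 abs_zero).eventually_le_const one_pos
  filter_upwards [hk, hlt] with t ht ht1 x hx
  obtain ⟨α, ψ, hψ, rfl⟩ := exists_eq_smul_add_of_ne_zero h.ne_zero x
  obtain ⟨hρ, hu⟩ := ht α ψ hψ hx
  have htest := h.inner_perturbedOp_corrector hv t (α • e + ψ)
  have hbe : ⟪b, e⟫ = 1 := by rw [real_inner_comm, hb]
  have key : κ * (t ^ 2 * ⟪b, α • e + ψ⟫) - 1 = t * (κ * ⟪b, t • ψ⟫ - ⟪b, v⟫ - ⟪t • ψ, r⟫ +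
      (t ^ 2 * α) * ⟪e, M₂ v⟫ + t * ⟪t • ψ, M₂ v⟫) := by
    rw [hx] at htest
    simp only [inner_add_right, inner_add_left, inner_sub_right _ _ (t • _), real_inner_smul_right,
      real_inner_smul_left, hbe, ← her] at htest ⊢
    linear_combination -htest
  rw [key, abs_mul]
  have : 0 ≤ k := (norm_nonneg _).trans hρ
  gcongr
  calc _ ≤ |κ| * |⟪b, t • ψ⟫| + |⟪b, v⟫| + |⟪t • ψ, r⟫| + |t ^ 2 * α| * |⟪e, M₂ v⟫| +
        |t| * |⟪t • ψ, M₂ v⟫| := by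
        simp only [← abs_mul]
        exact (abs_add_le _ _).trans (add_le_add_left ((abs_add_le _ _).trans (add_le_add_left
          ((abs_sub _ _).trans (add_le_add_left (abs_sub _ _) _)) _)) _)
    _ ≤ |κ| * (‖b‖ * k) + ‖b‖ * ‖v‖ + k * ‖r‖ + k * |⟪e, M₂ v⟫| + 1 * (k * ‖M₂ v‖) := by
        gcongr
        all_goals exact (abs_real_inner_le_norm _ _).trans (by gcongr)
    _ = _ := by ring

theorem tendsto_sq_mul_inner [CompleteSpace H] (h : IsGappedPerturbation M₀ M₁ M₂ e q)
    (hb : ⟪e, b⟫ = 1) {l : Filter ℝ} (hl : l ≤ 𝓝 0) {F : ℝ → H}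
    (hF : ∀ᶠ t in l, perturbedOp M₀ M₁ M₂ t (F t) = b) :
    Tendsto (fun t => t ^ 2 * ⟪b, F t⟫) l (𝓝 (secondOrderRate M₀ M₁ M₂ e)⁻¹) := by
  obtain ⟨C, hC⟩ := h.exists_abs_sq_mul_inner_sub_le hb
  set κ := secondOrderRate M₀ M₁ M₂ e
  have hbound : ∀ᶠ t in l, ‖κ * (t ^ 2 * ⟪b, F t⟫) - 1‖ ≤ |t| * C := by
    filter_upwards [hl hC, hF] with t ht hFt using ht (F t) hFt
  have hzero : Tendsto (fun t : ℝ => |t| * C) l (𝓝 0) :=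
    ((by fun_prop : Continuous fun t : ℝ => |t| * C).tendsto' 0 0 (by simp)).mono_left hl
  have hone : Tendsto (fun t => κ * (t ^ 2 * ⟪b, F t⟫)) l (𝓝 1) :=
    tendsto_sub_nhds_zero_iff.1 (squeeze_zero_norm' hbound hzero)
  simpa [κ, h.secondOrderRate_pos.ne'] using hone.const_mul κ⁻¹

end IsGappedPerturbation

end SpectralGap

section IntegralOperator

variable {α : Type*} [MeasurableSpace α] {μ : Measure α} {N : α → α → ℝ} {C : ℝ} {F G : α → ℝ}

lemma norm_toLp_sq (hF : MemLp F 2 μ) : ‖hF.toLp F‖ ^ 2 = ∫ x, F x ^ 2 ∂μ := by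
  rw [← real_inner_self_eq_norm_sq, L2.inner_def]
  refine integral_congr_ae ?_
  filter_upwards [hF.coeFn_toLp] with x hx
  simp [hx, sq]

lemma inner_toLp_toLp (hF : MemLp F 2 μ) (hG : MemLp G 2 μ) :
    ⟪hF.toLp F, hG.toLp G⟫ = ∫ x, F x * G x ∂μ := by
  rw [L2.inner_def]
  refine integral_congr_ae ?_
  filter_upwards [hF.coeFn_toLp, hG.coeFn_toLp] with x hx hy
  simp [hx, hy, mul_comm]

lemma Lp_norm_sq_eq_integral (F : Lp ℝ 2 μ) : ‖F‖ ^ 2 = ∫ x, F x ^ 2 ∂μ := by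
  rw [← norm_toLp_sq (Lp.memLp F), Lp.toLp_coeFn]

lemma sq_integral_mul_le {k f : α → ℝ} (hk₀ : ∀ y, 0 ≤ k y) (hk : Integrable k μ)
    (hkf : Integrable (fun y => k y * f y) μ) (hkf₂ : Integrable (fun y => k y * f y ^ 2) μ) :
    (∫ y, k y * f y ∂μ) ^ 2 ≤ (∫ y, k y ∂μ) * ∫ y, k y * f y ^ 2 ∂μ := by
  have hdiscrim := discrim_le_zero (a := ∫ y, k y ∂μ) (b := -2 * ∫ y, k y * f y ∂μ)
    (c := ∫ y, k y * f y ^ 2 ∂μ) fun m => by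
      have : 0 ≤ ∫ y, (m * m * k y + m * (-2) * (k y * f y)) + k y * f y ^ 2 ∂μ :=
        integral_nonneg fun y => by
          have := mul_nonneg (hk₀ y) (sq_nonneg (f y - m))
          simp only [Pi.zero_apply]
          linarith
      have hlin : Integrable (fun y => m * m * k y + m * (-2) * (k y * f y)) μ :=
        (hk.const_mul _).add (hkf.const_mul _)
      rw [integral_add hlin hkf₂, integral_add (hk.const_mul _) (hkf.const_mul _),
        integral_const_mul, integral_const_mul] at this
      linarith
  rw [discrim] at hdiscrim
  linarith

/-- The integral operator with kernel `N` with respect to `μ`, acting on functions. -/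
noncomputable def intOp (μ : Measure α) (N : α → α → ℝ) (F : α → ℝ) : α → ℝ :=
  fun x => ∫ y, N x y * F y ∂μ

lemma intOp_congr_ae (h : F =ᵐ[μ] G) : intOp μ N F = intOp μ N G := by
  funext x
  refine integral_congr_ae ?_
  filter_upwards [h] with y hy
  rw [hy]

lemma intOp_smul (c : ℝ) : intOp μ N (c • F) = c • intOp μ N F := by
  funext x
  simp only [intOp, Pi.smul_apply, smul_eq_mul, mul_left_comm (N x _), integral_const_mul]

/-- A kernel satisfying the hypotheses of the Schur test with constant `C`. The rows are also
required to be square integrable, so that `intOp μ N F x` converges for every `x` and not merely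
for almost every `x`. -/
structure IsSchurKernel (μ : Measure α) (N : α → α → ℝ) (C : ℝ) : Prop where
  nonneg : 0 ≤ C
  measurable : Measurable (Function.uncurry N)
  memLp_row : ∀ x, MemLp (N x) 2 μ
  integrable_row : ∀ x, Integrable (N x) μ
  integrable_col : ∀ y, Integrable (fun x => N x y) μ
  integral_row_le : ∀ x, ∫ y, |N x y| ∂μ ≤ C
  integral_col_le : ∀ y, ∫ x, |N x y| ∂μ ≤ C

namespace IsSchurKernel

lemma of_abs_le_sub {E : Type*} [MeasurableSpace E] [AddCommGroup E] [MeasurableAdd E]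
    [MeasurableNeg E] {μ : Measure E} [μ.IsAddLeftInvariant] [μ.IsNegInvariant]
    {N : E → E → ℝ} {k : E → ℝ} (hN : Measurable (Function.uncurry N))
    (hNk : ∀ x y, |N x y| ≤ k (y - x)) (hk : Integrable k μ) (hk₂ : MemLp k 2 μ)
    (hC : ∫ z, k z ∂μ ≤ C) : IsSchurKernel μ N C where
  nonneg := (integral_nonneg fun z => (abs_nonneg _).trans (by simpa using hNk 0 z)).trans hC
  measurable := hN
  memLp_row x := (hk₂.comp_measurePreserving (measurePreserving_sub_right μ x)).mono
    (hN.comp measurable_prodMk_left).aestronglyMeasurable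
    (.of_forall fun y => (hNk x y).trans (le_abs_self _))
  integrable_row x := (hk.comp_sub_right x).mono'
    (hN.comp measurable_prodMk_left).aestronglyMeasurable (.of_forall (hNk x))
  integrable_col y := (hk.comp_sub_left y).mono'
    (hN.comp measurable_prodMk_right).aestronglyMeasurable (.of_forall fun x => hNk x y)
  integral_row_le x := by
    rw [← integral_sub_right_eq_self k x] at hC
    refine le_trans ?_ hC
    exact integral_mono_of_nonneg (.of_forall fun _ => abs_nonneg _) (hk.comp_sub_right x)
      (.of_forall (hNk x))
  integral_col_le y := by
    rw [← integral_sub_left_eq_self k μ y] at hC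
    refine le_trans ?_ hC
    exact integral_mono_of_nonneg (.of_forall fun _ => abs_nonneg _) (hk.comp_sub_left y)
      (.of_forall fun x => hNk x y)

lemma integrable_row_mul (hN : IsSchurKernel μ N C) (hF : MemLp F 2 μ) (x : α) :
    Integrable (fun y => N x y * F y) μ :=
  (hN.memLp_row x).integrable_mul hF

lemma intOp_add (hN : IsSchurKernel μ N C) (hF : MemLp F 2 μ) (hG : MemLp G 2 μ) :
    intOp μ N (F + G) = intOp μ N F + intOp μ N G := by
  funext x
  simp only [intOp, Pi.add_apply, mul_add]
  exact integral_add (hN.integrable_row_mul hF x) (hN.integrable_row_mul hG x)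

variable [SFinite μ]

lemma integrable_abs_mul_sq_snd (hN : IsSchurKernel μ N C) (hF : MemLp F 2 μ) :
    Integrable (fun p : α × α => |N p.1 p.2| * F p.2 ^ 2) (μ.prod μ) := by
  have hmeas : AEStronglyMeasurable (fun p : α × α => |N p.1 p.2| * F p.2 ^ 2) (μ.prod μ) :=
    hN.measurable.abs.aestronglyMeasurable.mul (hF.aestronglyMeasurable.comp_snd.pow 2)
  refine (integrable_prod_iff' hmeas).2 ⟨.of_forall fun y =>
    (hN.integrable_col y).abs.mul_const (F y ^ 2),
    (hF.integrable_sq.const_mul C).mono' hmeas.norm.prod_swap.integral_prod_right'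
      (.of_forall fun y => ?_)⟩
  simp only [norm_mul, Real.norm_eq_abs, abs_abs, abs_sq, integral_mul_const]
  rw [abs_of_nonneg (integral_nonneg fun _ => abs_nonneg _)]
  exact mul_le_mul_of_nonneg_right (hN.integral_col_le y) (sq_nonneg _)

lemma integrable_abs_mul_sq_fst (hN : IsSchurKernel μ N C) (hG : MemLp G 2 μ) :
    Integrable (fun p : α × α => |N p.1 p.2| * G p.1 ^ 2) (μ.prod μ) := by
  have hmeas : AEStronglyMeasurable (fun p : α × α => |N p.1 p.2| * G p.1 ^ 2) (μ.prod μ) :=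
    hN.measurable.abs.aestronglyMeasurable.mul (hG.aestronglyMeasurable.comp_fst.pow 2)
  refine (integrable_prod_iff hmeas).2 ⟨.of_forall fun x =>
    (hN.integrable_row x).abs.mul_const (G x ^ 2),
    (hG.integrable_sq.const_mul C).mono' hmeas.norm.integral_prod_right' (.of_forall fun x => ?_)⟩
  simp only [norm_mul, Real.norm_eq_abs, abs_abs, abs_sq, integral_mul_const]
  rw [abs_of_nonneg (integral_nonneg fun _ => abs_nonneg _)]
  exact mul_le_mul_of_nonneg_right (hN.integral_row_le x) (sq_nonneg _)

lemma integrable_prod_mul_mul (hN : IsSchurKernel μ N C) (hF : MemLp F 2 μ) (hG : MemLp G 2 μ) :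
    Integrable (fun p : α × α => N p.1 p.2 * F p.2 * G p.1) (μ.prod μ) := by
  refine ((hN.integrable_abs_mul_sq_snd hF).add (hN.integrable_abs_mul_sq_fst hG)).mono'
    ((hN.measurable.aestronglyMeasurable.mul hF.aestronglyMeasurable.comp_snd).mul
      hG.aestronglyMeasurable.comp_fst) (.of_forall fun p => ?_)
  have hamgm : |F p.2| * |G p.1| ≤ F p.2 ^ 2 + G p.1 ^ 2 := by
    nlinarith [sq_abs (F p.2), sq_abs (G p.1), sq_nonneg (|F p.2| - |G p.1|),
      sq_nonneg (F p.2), sq_nonneg (G p.1)]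
  simpa only [Real.norm_eq_abs, abs_mul, mul_assoc, Pi.add_apply, mul_add] using
    mul_le_mul_of_nonneg_left hamgm (abs_nonneg (N p.1 p.2))

lemma sq_intOp_le (hN : IsSchurKernel μ N C) (hF : MemLp F 2 μ) :
    ∀ᵐ x ∂μ, intOp μ N F x ^ 2 ≤ C * ∫ y, |N x y| * F y ^ 2 ∂μ := by
  filter_upwards [(hN.integrable_abs_mul_sq_snd hF).prod_right_ae] with x hx
  have habs : |intOp μ N F x| ≤ ∫ y, |N x y| * |F y| ∂μ := by
    simpa only [intOp, abs_mul] using abs_integral_le_integral_abs (f := fun y => N x y * F y)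
  calc intOp μ N F x ^ 2 = |intOp μ N F x| ^ 2 := (sq_abs _).symm
    _ ≤ (∫ y, |N x y| * |F y| ∂μ) ^ 2 := by gcongr
    _ ≤ (∫ y, |N x y| ∂μ) * ∫ y, |N x y| * |F y| ^ 2 ∂μ :=
        sq_integral_mul_le (fun _ => abs_nonneg _) (hN.integrable_row x).abs
          (by simpa only [abs_mul] using (hN.integrable_row_mul hF x).abs)
          (by simpa only [sq_abs] using hx)
    _ ≤ C * ∫ y, |N x y| * F y ^ 2 ∂μ := by
        simp only [sq_abs]
        gcongr
        exact hN.integral_row_le x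

lemma memLp_intOp (hN : IsSchurKernel μ N C) (hF : MemLp F 2 μ) : MemLp (intOp μ N F) 2 μ := by
  have hmeas : AEStronglyMeasurable (intOp μ N F) μ :=
    (hN.measurable.aestronglyMeasurable.mul hF.aestronglyMeasurable.comp_snd).integral_prod_right'
  refine (memLp_two_iff_integrable_sq hmeas).2 (Integrable.mono'
    ((hN.integrable_abs_mul_sq_snd hF).integral_prod_left.const_mul C) (hmeas.pow 2) ?_)
  filter_upwards [hN.sq_intOp_le hF] with x hx
  rwa [Real.norm_of_nonneg (sq_nonneg _)]

lemma integral_sq_intOp_le (hN : IsSchurKernel μ N C) (hF : MemLp F 2 μ) :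
    ∫ x, intOp μ N F x ^ 2 ∂μ ≤ C ^ 2 * ∫ x, F x ^ 2 ∂μ := by
  have hint := hN.integrable_abs_mul_sq_snd hF
  calc ∫ x, intOp μ N F x ^ 2 ∂μ ≤ ∫ x, C * ∫ y, |N x y| * F y ^ 2 ∂μ ∂μ :=
        integral_mono_ae (hN.memLp_intOp hF).integrable_sq (hint.integral_prod_left.const_mul C)
          (hN.sq_intOp_le hF)
    _ = C * ∫ y, (∫ x, |N x y| ∂μ) * F y ^ 2 ∂μ := by
        rw [integral_const_mul, integral_integral_swap hint]
        simp only [integral_mul_const]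
    _ ≤ C * ∫ y, C * F y ^ 2 ∂μ := by
        refine mul_le_mul_of_nonneg_left (integral_mono_of_nonneg
          (.of_forall fun y => mul_nonneg (integral_nonneg fun _ => abs_nonneg _) (sq_nonneg _))
          (hF.integrable_sq.const_mul C) (.of_forall fun y => ?_)) hN.nonneg
        exact mul_le_mul_of_nonneg_right (hN.integral_col_le y) (sq_nonneg _)
    _ = C ^ 2 * ∫ y, F y ^ 2 ∂μ := by rw [integral_const_mul]; ring

lemma norm_toLp_intOp_le (hN : IsSchurKernel μ N C) (hF : MemLp F 2 μ) :
    ‖(hN.memLp_intOp hF).toLp‖ ≤ C * ‖hF.toLp‖ := by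
  refine le_of_sq_le_sq ?_ (mul_nonneg hN.nonneg (norm_nonneg _))
  rw [mul_pow, norm_toLp_sq, norm_toLp_sq]
  exact hN.integral_sq_intOp_le hF

/-- The bounded operator on `L²(μ)` given by a Schur kernel. -/
noncomputable def toCLM (hN : IsSchurKernel μ N C) : Lp ℝ 2 μ →L[ℝ] Lp ℝ 2 μ :=
  LinearMap.mkContinuous
    { toFun := fun F => (hN.memLp_intOp (Lp.memLp F)).toLp
      map_add' := fun F G => by
        rw [← MemLp.toLp_add]
        congr 1
        rw [intOp_congr_ae (Lp.coeFn_add F G), hN.intOp_add (Lp.memLp F) (Lp.memLp G)]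
      map_smul' := fun c F => by
        rw [RingHom.id_apply, ← MemLp.toLp_const_smul]
        congr 1
        rw [intOp_congr_ae (Lp.coeFn_smul c F), intOp_smul] }
    C fun F => by
      have := hN.norm_toLp_intOp_le (Lp.memLp F)
      rwa [Lp.toLp_coeFn] at this

lemma coeFn_toCLM (hN : IsSchurKernel μ N C) (F : Lp ℝ 2 μ) :
    hN.toCLM F =ᵐ[μ] intOp μ N F := (hN.memLp_intOp (Lp.memLp F)).coeFn_toLp

lemma toCLM_toLp (hN : IsSchurKernel μ N C) (hF : MemLp F 2 μ) :
    hN.toCLM (hF.toLp F) = (hN.memLp_intOp hF).toLp := by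
  change (hN.memLp_intOp (Lp.memLp _)).toLp _ = _
  congr 1
  exact intOp_congr_ae hF.coeFn_toLp

lemma norm_toCLM_sq (hN : IsSchurKernel μ N C) (F : Lp ℝ 2 μ) :
    ‖hN.toCLM F‖ ^ 2 = ∫ x, intOp μ N F x ^ 2 ∂μ :=
  norm_toLp_sq (hN.memLp_intOp (Lp.memLp F))

lemma inner_toCLM (hN : IsSchurKernel μ N C) (F G : Lp ℝ 2 μ) :
    ⟪hN.toCLM F, G⟫ = ∫ x, ∫ y, N x y * F y * G x ∂μ ∂μ := by
  rw [L2.inner_def]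
  refine integral_congr_ae ?_
  filter_upwards [hN.coeFn_toCLM F] with x hx
  rw [integral_mul_const, hx]
  simp [intOp, mul_comm]

lemma inner_toCLM_swap (hN : IsSchurKernel μ N C) {c : ℝ} (hc : ∀ x y, N y x = c * N x y)
    (F G : Lp ℝ 2 μ) : ⟪hN.toCLM F, G⟫ = c * ⟪F, hN.toCLM G⟫ := by
  rw [real_inner_comm (hN.toCLM G) F, inner_toCLM, inner_toCLM,
    integral_integral_swap (hN.integrable_prod_mul_mul (Lp.memLp F) (Lp.memLp G)),
    ← integral_const_mul]
  congr 1; funext x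
  rw [← integral_const_mul]
  congr 1; funext y
  rw [hc x y]; ring

end IsSchurKernel

/-- `e` is a strictly positive square integrable fixed vector of the integral operator with
nonnegative symmetric kernel `N`. -/
structure IsGroundState (μ : Measure α) (N : α → α → ℝ) (e : α → ℝ) : Prop where
  kernel_nonneg : ∀ x y, 0 ≤ N x y
  kernel_symm : ∀ x y, N y x = N x y
  measurable : Measurable e
  pos : ∀ x, 0 < e x
  memLp : MemLp e 2 μ
  fixed : ∀ x, intOp μ N e x = e x

/-- Doob's transform of the kernel `N` by `e`: if `e` is a ground state of `N`, then the measure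
`e²μ` is reversible for the Markov kernel `N x y e y / e x`, whose density at `y` with respect to
`e²μ`, times `(e x)²`, is `doobKernel N e x y`. -/
noncomputable def doobKernel (N : α → α → ℝ) (e : α → ℝ) (x y : α) : ℝ := e x * N x y / e y

/-- The variance of `F / e` under the Markov kernel `N x y e y / e x`, times `(e x)²`. -/
noncomputable def localVar (μ : Measure α) (N : α → α → ℝ) (e F : α → ℝ) (x : α) : ℝ :=
  ∫ y, doobKernel N e x y * (F y - intOp μ N F x / e x * e y) ^ 2 ∂μ

namespace IsGroundState

variable {e : α → ℝ}

lemma doobKernel_nonneg (he : IsGroundState μ N e) (x y : α) : 0 ≤ doobKernel N e x y :=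
  div_nonneg (mul_nonneg (he.pos x).le (he.kernel_nonneg x y)) (he.pos y).le

lemma localVar_nonneg (he : IsGroundState μ N e) (F : α → ℝ) (x : α) : 0 ≤ localVar μ N e F x :=
  integral_nonneg fun y => mul_nonneg (he.doobKernel_nonneg x y) (sq_nonneg _)

lemma integrable_doobKernel_col (he : IsGroundState μ N e) (hN : IsSchurKernel μ N C) (y : α) :
    Integrable (fun x => doobKernel N e x y) μ := by
  simpa only [doobKernel, he.kernel_symm y, mul_comm (e _)] using
    (hN.integrable_row_mul he.memLp y).div_const (e y)

lemma integral_doobKernel_col (he : IsGroundState μ N e) (y : α) :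
    ∫ x, doobKernel N e x y ∂μ = 1 := by
  have hfix : ∫ x, N x y * e x ∂μ = e y := by simpa only [intOp, he.kernel_symm] using he.fixed y
  simp only [doobKernel, mul_comm (e _)]
  rw [integral_div, hfix, div_self (he.pos y).ne']

variable [SFinite μ]

lemma integrable_doobKernel_mul_sq (he : IsGroundState μ N e) (hN : IsSchurKernel μ N C)
    (hF : MemLp F 2 μ) :
    Integrable (fun p : α × α => doobKernel N e p.1 p.2 * F p.2 ^ 2) (μ.prod μ) := by
  have hdoob : Measurable fun p : α × α => doobKernel N e p.1 p.2 :=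
    ((he.measurable.comp measurable_fst).mul hN.measurable).div (he.measurable.comp measurable_snd)
  have hmeas : AEStronglyMeasurable (fun p : α × α => doobKernel N e p.1 p.2 * F p.2 ^ 2)
      (μ.prod μ) :=
    hdoob.aestronglyMeasurable.mul (hF.aestronglyMeasurable.comp_snd.pow 2)
  rw [integrable_prod_iff' hmeas]
  refine ⟨.of_forall fun y => (he.integrable_doobKernel_col hN y).mul_const (F y ^ 2), ?_⟩
  simp only [norm_mul, Real.norm_of_nonneg (he.doobKernel_nonneg _ _), integral_mul_const,
    he.integral_doobKernel_col, one_mul, Real.norm_of_nonneg (sq_nonneg _)]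
  exact hF.integrable_sq

lemma integral_doobKernel_mul_sq (he : IsGroundState μ N e) (hN : IsSchurKernel μ N C)
    (hF : MemLp F 2 μ) :
    ∫ x, ∫ y, doobKernel N e x y * F y ^ 2 ∂μ ∂μ = ∫ y, F y ^ 2 ∂μ := by
  rw [integral_integral_swap (he.integrable_doobKernel_mul_sq hN hF)]
  simp only [integral_mul_const, he.integral_doobKernel_col, one_mul]

lemma localVar_ae (he : IsGroundState μ N e) (hN : IsSchurKernel μ N C) (hF : MemLp F 2 μ) :
    ∀ᵐ x ∂μ,
      Integrable (fun y => doobKernel N e x y * (F y - intOp μ N F x / e x * e y) ^ 2) μ ∧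
      localVar μ N e F x = (∫ y, doobKernel N e x y * F y ^ 2 ∂μ) - intOp μ N F x ^ 2 := by
  filter_upwards [(he.integrable_doobKernel_mul_sq hN hF).prod_right_ae] with x hFx
  have hex := he.pos x
  set m := intOp μ N F x / e x
  have hexpand : (fun y => doobKernel N e x y * (F y - m * e y) ^ 2) = fun y =>
      doobKernel N e x y * F y ^ 2 - 2 * m * e x * (N x y * F y) + m ^ 2 * e x * (N x y * e y) := by
    funext y
    have := he.pos y
    simp only [doobKernel]
    field_simp
    ring
  have hNF := (hN.integrable_row_mul hF x).const_mul (2 * m * e x)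
  have hNe := (hN.integrable_row_mul he.memLp x).const_mul (m ^ 2 * e x)
  have hfix : ∫ y, N x y * e y ∂μ = e x := he.fixed x
  have hm : ∫ y, N x y * F y ∂μ = m * e x := (div_mul_cancel₀ _ hex.ne').symm
  have hsub : Integrable (fun y => doobKernel N e x y * F y ^ 2 - 2 * m * e x * (N x y * F y)) μ :=
    hFx.sub hNF
  refine ⟨hexpand ▸ hsub.add hNe, ?_⟩
  rw [localVar, hexpand, integral_add hsub hNe, integral_sub hFx hNF, integral_const_mul,
    integral_const_mul, hfix, intOp, hm]
  ring

lemma integrable_localVar (he : IsGroundState μ N e) (hN : IsSchurKernel μ N C)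
    (hF : MemLp F 2 μ) : Integrable (localVar μ N e F) μ :=
  ((he.integrable_doobKernel_mul_sq hN hF).integral_prod_left.sub
    (hN.memLp_intOp hF).integrable_sq).congr ((he.localVar_ae hN hF).mono fun _ hx => hx.2.symm)

lemma integral_localVar (he : IsGroundState μ N e) (hN : IsSchurKernel μ N C)
    (hF : MemLp F 2 μ) :
    ∫ x, localVar μ N e F x ∂μ = ∫ x, F x ^ 2 ∂μ - ∫ x, intOp μ N F x ^ 2 ∂μ := by
  rw [integral_congr_ae ((he.localVar_ae hN hF).mono fun _ hx => hx.2),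
    integral_sub (he.integrable_doobKernel_mul_sq hN hF).integral_prod_left
      (hN.memLp_intOp hF).integrable_sq, he.integral_doobKernel_mul_sq hN hF]

variable {A B : Set α} {c : ℝ}

-- Some point of `A` has at most average local variance; started there, the Markov kernel charges
-- all of `B`.
lemma local_poincare (he : IsGroundState μ N e) (hN : IsSchurKernel μ N C)
    (hA : MeasurableSet A) (hA₀ : μ A ≠ 0) (hA_top : μ A ≠ ⊤) (hB : MeasurableSet B)
    (hc : ∀ x ∈ A, ∀ y ∈ B, c ≤ doobKernel N e x y) (hF : MemLp F 2 μ) :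
    ∃ m, μ.real A * c * ∫ y in B, (F y - m * e y) ^ 2 ∂μ ≤
      ∫ x, F x ^ 2 ∂μ - ∫ x, intOp μ N F x ^ 2 ∂μ := by
  have hV := he.integrable_localVar hN hF
  have : Fact (μ A < ⊤) := ⟨hA_top.lt_top⟩
  have hgood : ∀ᵐ x ∂μ.restrict A, x ∈ A ∧
      Integrable (fun y => doobKernel N e x y * (F y - intOp μ N F x / e x * e y) ^ 2) μ :=
    (ae_restrict_mem hA).and (ae_restrict_of_ae ((he.localVar_ae hN hF).mono fun _ hx => hx.1))
  obtain ⟨x, hx, hxV⟩ := exists_notMem_null_le_average (by simpa using hA₀)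
    (hV.mono_measure Measure.restrict_le_self) hgood
  obtain ⟨hxA, hxint⟩ := not_not.1 hx
  set m := intOp μ N F x / e x
  have hFm : Integrable (fun y => c * (F y - m * e y) ^ 2) μ :=
    (hF.sub (he.memLp.const_mul m)).integrable_sq.const_mul c
  have hB_le : c * ∫ y in B, (F y - m * e y) ^ 2 ∂μ ≤ localVar μ N e F x := by
    rw [← integral_const_mul]
    refine (setIntegral_mono_on hFm.integrableOn hxint.integrableOn hB fun y hy =>
      mul_le_mul_of_nonneg_right (hc x hxA y hy) (sq_nonneg _)).trans
      (setIntegral_le_integral hxint (.of_forall fun y =>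
        mul_nonneg (he.doobKernel_nonneg x y) (sq_nonneg _)))
  refine ⟨m, ?_⟩
  calc μ.real A * c * ∫ y in B, (F y - m * e y) ^ 2 ∂μ
      ≤ μ.real A * ⨍ x in A, localVar μ N e F x ∂μ := by
        rw [mul_assoc]
        gcongr
        exact hB_le.trans hxV
    _ = ∫ x in A, localVar μ N e F x ∂μ := by
        rw [← smul_eq_mul, measure_smul_setAverage _ hA_top]
    _ ≤ ∫ x, localVar μ N e F x ∂μ :=
        setIntegral_le_integral hV (.of_forall (he.localVar_nonneg F))
    _ = _ := he.integral_localVar hN hF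

lemma norm_toCLM_le (he : IsGroundState μ N e) (hN : IsSchurKernel μ N C) (F : Lp ℝ 2 μ) :
    ‖hN.toCLM F‖ ≤ ‖F‖ := by
  refine le_of_sq_le_sq ?_ (norm_nonneg _)
  rw [hN.norm_toCLM_sq, Lp_norm_sq_eq_integral, ← sub_nonneg,
    ← he.integral_localVar hN (Lp.memLp F)]
  exact integral_nonneg (he.localVar_nonneg F)

lemma toCLM_fixed (he : IsGroundState μ N e) (hN : IsSchurKernel μ N C) :
    hN.toCLM (he.memLp.toLp e) = he.memLp.toLp e := by
  rw [hN.toCLM_toLp]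
  congr 1
  exact funext he.fixed

theorem exists_hasSpectralGap_toCLM (he : IsGroundState μ N e) (hN : IsSchurKernel μ N C)
    (hA : MeasurableSet A) (hA₀ : μ A ≠ 0) (hA_top : μ A ≠ ⊤) (hB : MeasurableSet B) (hc₀ : 0 < c)
    (hc : ∀ x ∈ A, ∀ y ∈ B, c ≤ doobKernel N e x y)
    (htail : IsSchurKernel μ (fun x => Bᶜ.indicator (N x)) (1 / 2)) :
    ∃ q, HasSpectralGap hN.toCLM (he.memLp.toLp e) q := by
  have hsymm : (hN.toCLM : Lp ℝ 2 μ →ₗ[ℝ] Lp ℝ 2 μ).IsSymmetric := fun F G => by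
    simpa using hN.inner_toCLM_swap (c := 1) (by simpa using he.kernel_symm) F G
  have hcA : 0 < μ.real A * c := mul_pos (ENNReal.toReal_pos hA₀ hA_top) hc₀
  refine exists_hasSpectralGap hsymm (he.toCLM_fixed hN) (he.norm_toCLM_le hN) hcA fun F => ?_
  obtain ⟨m, hm⟩ := he.local_poincare hN hA hA₀ hA_top hB hc (Lp.memLp F)
  set F' := F - m • he.memLp.toLp e
  have hF' : F' =ᵐ[μ] fun y => F y - m * e y := by
    filter_upwards [Lp.coeFn_sub F (m • he.memLp.toLp e), Lp.coeFn_smul m (he.memLp.toLp e),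
      he.memLp.coeFn_toLp] with y hsub hsmul hey
    rw [hsub, Pi.sub_apply, hsmul, Pi.smul_apply, hey, smul_eq_mul]
  have hInd := (Lp.memLp F').indicator hB
  have hIndc := (Lp.memLp F').indicator hB.compl
  refine ⟨m, hInd.toLp, hIndc.toLp, ?_, ?_, ?_⟩
  · rw [← MemLp.toLp_add]
    simp only [Set.indicator_self_add_compl, Lp.toLp_coeFn]
    rfl
  · rw [norm_toLp_sq, Lp_norm_sq_eq_integral, hN.norm_toCLM_sq]
    convert hm using 2
    rw [← integral_indicator hB]
    refine integral_congr_ae ?_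
    filter_upwards [hF'] with y hy
    by_cases hyB : y ∈ B <;> simp [hyB, hy]
  · have htrunc : intOp μ N (Bᶜ.indicator F') = intOp μ (fun x => Bᶜ.indicator (N x)) F' := by
      funext x
      exact integral_congr_ae (.of_forall fun y => by by_cases hy : y ∈ B <;> simp [hy])
    have := htail.norm_toLp_intOp_le (Lp.memLp F')
    rw [hN.toCLM_toLp]
    simp only [htrunc]
    simpa only [Lp.toLp_coeFn] using this

end IsGroundState

end IntegralOperator

section Exponentials

lemma exp_sub_one_eq_mul_sinh (x : ℝ) :
    Real.exp x - 1 = 2 * Real.exp (x / 2) * Real.sinh (x / 2) := by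
  have hx : Real.exp x = Real.exp (x / 2) ^ 2 := by rw [← Real.exp_nat_mul]; ring_nf
  rw [Real.sinh_eq, Real.exp_neg, hx]
  field_simp

lemma exp_add_one_eq_mul_cosh (x : ℝ) :
    Real.exp x + 1 = 2 * Real.exp (x / 2) * Real.cosh (x / 2) := by
  have hx : Real.exp x = Real.exp (x / 2) ^ 2 := by rw [← Real.exp_nat_mul]; ring_nf
  rw [Real.cosh_eq, Real.exp_neg, hx]
  field_simp

lemma cosh_le_exp_abs (x : ℝ) : Real.cosh x ≤ Real.exp |x| := by
  rw [← Real.cosh_abs, Real.cosh_eq]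
  linarith [Real.exp_le_exp.2 (neg_le_self (abs_nonneg x))]

lemma exp_abs_div_two_le_cosh (x : ℝ) : Real.exp |x| / 2 ≤ Real.cosh x := by
  rw [← Real.cosh_abs, Real.cosh_eq]
  linarith [Real.exp_pos (-|x|)]

lemma mul_exp_div_two_le_sinh {x : ℝ} (hx : 0 ≤ x) : x * Real.exp (x / 2) / 2 ≤ Real.sinh x := by
  have hsinh : x / 2 ≤ Real.sinh (x / 2) := Real.self_le_sinh_iff.2 (by positivity)
  have hcosh := exp_abs_div_two_le_cosh (x / 2)
  rw [abs_of_nonneg (by positivity)] at hcosh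
  calc x * Real.exp (x / 2) / 2 = 2 * (x / 2) * (Real.exp (x / 2) / 2) := by ring
    _ ≤ 2 * Real.sinh (x / 2) * Real.cosh (x / 2) := by gcongr
    _ = Real.sinh x := by rw [← Real.sinh_two_mul]; congr 1; ring

lemma integrable_abs_pow_mul_exp {c : ℝ} (hc : 0 < c) (n : ℕ) :
    Integrable fun x : ℝ => |x| ^ n * Real.exp (-c * |x|) := by
  have hIoi : IntegrableOn (fun r : ℝ => r ^ n * Real.exp (-c * r)) (Set.Ioi 0) := by
    simpa using integrableOn_rpow_mul_exp_neg_mul_rpow (s := n) (p := 1) (b := c)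
      (by linarith [n.cast_nonneg (α := ℝ)]) one_pos hc
  simpa using (integrable_fun_norm_addHaar (μ := (volume : Measure ℝ))
    (f := fun r : ℝ => r ^ n * Real.exp (-c * r))).2 (by simpa using hIoi)

lemma integrable_inv_cosh : Integrable fun x : ℝ => (Real.cosh (x / 2))⁻¹ := by
  refine ((integrable_abs_pow_mul_exp (c := 1 / 2) (by norm_num) 0).const_mul 2).mono'
    (by fun_prop) (.of_forall fun x => ?_)
  have hexp := exp_abs_div_two_le_cosh (x / 2)
  rw [Real.norm_of_nonneg (by positivity), pow_zero, one_mul, neg_mul, Real.exp_neg]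
  rw [show |x / 2| = 1 / 2 * |x| by rw [abs_div, abs_two]; ring] at hexp
  calc (Real.cosh (x / 2))⁻¹ ≤ (Real.exp (1 / 2 * |x|) / 2)⁻¹ := by gcongr
    _ = _ := by rw [inv_div]; rfl

end Exponentials

namespace Bloch

lemma f₀_eq_sigmoid (x : ℝ) : f₀ x = Real.sigmoid (-x) := by
  simp [f₀, Real.sigmoid, add_comm]

lemma w_eq (T ε : ℝ) : w T ε = (4 * Real.cosh (ε / T / 2) ^ 2)⁻¹ := by
  have hx := exp_add_one_eq_mul_cosh (ε / T)
  have hsq : Real.exp (ε / T) = Real.exp (ε / T / 2) ^ 2 := by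
    rw [← Real.exp_nat_mul]; congr 1; push_cast; ring
  rw [w, f₀, one_sub_div (by positivity), add_sub_cancel_right, hx, hsq]
  field_simp
  norm_num

lemma integrable_w_one : Integrable (w 1) := by
  refine integrable_inv_cosh.mono' (by simp only [funext (w_eq 1)]; fun_prop)
    (.of_forall fun x => ?_)
  have hcosh := Real.one_le_cosh (x / 2)
  rw [w_eq, div_one, Real.norm_of_nonneg (by positivity)]
  gcongr
  nlinarith

lemma integral_w_one : ∫ x, w 1 x = 1 := by
  have hw (x : ℝ) : w 1 x = Real.sigmoid x * (1 - Real.sigmoid x) := by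
    rw [w, div_one, f₀_eq_sigmoid, Real.sigmoid_neg]
    ring
  have hderiv (x : ℝ) : HasDerivAt Real.sigmoid (w 1 x) x := hw x ▸ Real.hasDerivAt_sigmoid x
  rw [integral_of_hasDerivAt_of_tendsto hderiv integrable_w_one
    Real.tendsto_sigmoid_atBot Real.tendsto_sigmoid_atTop, sub_zero]

/-- The even function `z² sgn z / (2 sinh (z/2))`, the translation invariant factor of the
dimensionless kernel `kbar₀`. -/
noncomputable def bosonKernel (z : ℝ) : ℝ := z ^ 2 / (2 * Real.sinh (|z| / 2))

lemma bosonKernel_neg (z : ℝ) : bosonKernel (-z) = bosonKernel z := by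
  simp [bosonKernel]

lemma bosonKernel_nonneg (z : ℝ) : 0 ≤ bosonKernel z :=
  div_nonneg (sq_nonneg z) (mul_nonneg two_pos.le (Real.sinh_nonneg_iff.2 (by positivity)))

lemma measurable_bosonKernel : Measurable bosonKernel := by
  unfold bosonKernel
  fun_prop

lemma le_bosonKernel (z : ℝ) : z ^ 2 * Real.exp (-(|z| / 2)) ≤ bosonKernel z := by
  rcases eq_or_ne z 0 with rfl | hz
  · simp [bosonKernel]
  have : 0 < Real.sinh (|z| / 2) := Real.sinh_pos_iff.2 (by positivity)
  rw [Real.exp_neg, ← div_eq_mul_inv, bosonKernel]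
  gcongr
  rw [Real.sinh_eq]
  linarith [Real.exp_pos (-(|z| / 2))]

lemma bosonKernel_le (z : ℝ) : bosonKernel z ≤ 2 * |z| * Real.exp (-(|z| / 4)) := by
  rcases eq_or_ne z 0 with rfl | hz
  · simp [bosonKernel]
  have hsinh := mul_exp_div_two_le_sinh (x := |z| / 2) (by positivity)
  rw [bosonKernel, ← sq_abs]
  calc |z| ^ 2 / (2 * Real.sinh (|z| / 2))
      ≤ |z| ^ 2 / (2 * (|z| / 2 * Real.exp (|z| / 2 / 2) / 2)) := by gcongr
    _ = 2 * |z| * Real.exp (-(|z| / 4)) := by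
        rw [Real.exp_neg, show |z| / 2 / 2 = |z| / 4 by ring]
        field_simp

/-- A dominating function for `zⁱ bosonKernel z` that is both integrable and square integrable. -/
noncomputable def bosonBound (i : ℕ) (z : ℝ) : ℝ := 2 * (|z| ^ (i + 1) * Real.exp (-(1 / 4) * |z|))

lemma abs_pow_mul_bosonKernel_le (i : ℕ) (z : ℝ) : |z ^ i * bosonKernel z| ≤ bosonBound i z := by
  rw [abs_mul, abs_pow, abs_of_nonneg (bosonKernel_nonneg z), bosonBound]
  calc |z| ^ i * bosonKernel z ≤ |z| ^ i * (2 * |z| * Real.exp (-(|z| / 4))) := by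
        gcongr
        exact bosonKernel_le z
    _ = _ := by rw [show -(|z| / 4) = -(1 / 4) * |z| by ring]; ring

lemma bosonBound_nonneg (i : ℕ) (z : ℝ) : 0 ≤ bosonBound i z := by
  unfold bosonBound
  positivity

lemma integrable_bosonBound (i : ℕ) : Integrable (bosonBound i) :=
  (integrable_abs_pow_mul_exp (by norm_num) _).const_mul 2

lemma memLp_bosonBound (i : ℕ) : MemLp (bosonBound i) 2 := by
  rw [memLp_two_iff_integrable_sq (integrable_bosonBound i).aestronglyMeasurable]
  refine ((integrable_abs_pow_mul_exp (c := 1 / 2) (by norm_num) (2 * (i + 1))).const_mul 4).congr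
    (.of_forall fun z => ?_)
  have hexp : Real.exp (-(1 / 2) * |z|) = Real.exp (-(1 / 4) * |z|) ^ 2 := by
    rw [← Real.exp_nat_mul]; congr 1; push_cast; ring
  simp only [bosonBound, hexp]
  ring

lemma integrable_bosonKernel : Integrable bosonKernel :=
  (integrable_bosonBound 0).mono' measurable_bosonKernel.aestronglyMeasurable
    (.of_forall fun z => by simpa using abs_pow_mul_bosonKernel_le 0 z)

lemma integral_bosonKernel_pos : 0 < ∫ z, bosonKernel z := by
  rw [integral_pos_iff_support_of_nonneg bosonKernel_nonneg integrable_bosonKernel]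
  refine lt_of_lt_of_le (b := volume (Set.Ioi (0 : ℝ))) (by simp) (measure_mono fun z hz => ?_)
  exact ((mul_pos (sq_pos_of_pos hz) (Real.exp_pos _)).trans_le (le_bosonKernel z)).ne'

lemma sq_mul_sign_div_sinh (z : ℝ) :
    z ^ 2 * Real.sign z / (2 * Real.sinh (z / 2)) = bosonKernel z := by
  rcases lt_trichotomy z 0 with hz | rfl | hz
  · rw [bosonKernel, Real.sign_of_neg hz, abs_of_neg hz, neg_div, Real.sinh_neg]
    rw [mul_neg, mul_one, mul_neg, div_neg, neg_div]
  · simp [bosonKernel]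
  · rw [bosonKernel, Real.sign_of_pos hz, abs_of_pos hz, mul_one]

lemma n₀_add_f₀ {x y : ℝ} (h : y - x ≠ 0) :
    n₀ (y - x) + f₀ y =
      Real.cosh (x / 2) / (2 * Real.sinh ((y - x) / 2) * Real.cosh (y / 2)) := by
  have hsinh : Real.sinh ((y - x) / 2) ≠ 0 := Real.sinh_ne_zero.2 (div_ne_zero h two_ne_zero)
  have hcosh : Real.cosh (x / 2) = Real.cosh (y / 2 - (y - x) / 2) := by congr 1; ring
  rw [n₀, f₀, exp_sub_one_eq_mul_sinh, exp_add_one_eq_mul_cosh, hcosh, Real.cosh_sub]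
  field_simp
  rw [Real.cosh_eq, Real.sinh_eq, Real.cosh_eq, Real.sinh_eq, Real.exp_neg, Real.exp_neg]
  field_simp
  ring

lemma kbar₀_eq (x y : ℝ) :
    kbar₀ x (y - x) = bosonKernel (y - x) * Real.cosh (x / 2) / Real.cosh (y / 2) := by
  rcases eq_or_ne (y - x) 0 with hz | hz
  · simp [kbar₀, bosonKernel, hz]
  rw [kbar₀, sub_add_cancel, n₀_add_f₀ hz, ← sq_mul_sign_div_sinh]
  ring

lemma le_kbar₀ (x y : ℝ) :
    (y - x) ^ 2 / 2 * Real.exp ((|x| - |y| - |y - x|) / 2) ≤ kbar₀ x (y - x) := by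
  have hx := exp_abs_div_two_le_cosh (x / 2)
  have hy := cosh_le_exp_abs (y / 2)
  rw [abs_div, abs_two] at hx hy
  rw [kbar₀_eq]
  calc (y - x) ^ 2 / 2 * Real.exp ((|x| - |y| - |y - x|) / 2)
      = (y - x) ^ 2 * Real.exp (-(|y - x| / 2)) * (Real.exp (|x| / 2) / 2) /
          Real.exp (|y| / 2) := by
        rw [show (|x| - |y| - |y - x|) / 2 = -(|y - x| / 2) + |x| / 2 - |y| / 2 by ring,
          Real.exp_sub, Real.exp_add]
        ring
    _ ≤ bosonKernel (y - x) * Real.cosh (x / 2) / Real.cosh (y / 2) := by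
        gcongr
        · exact mul_nonneg (bosonKernel_nonneg _) (by positivity)
        · exact bosonKernel_nonneg _
        · exact le_bosonKernel _

lemma kbar₀_nonneg (x y : ℝ) : 0 ≤ kbar₀ x (y - x) := le_trans (by positivity) (le_kbar₀ x y)

lemma kbar₀_neg (x y : ℝ) : kbar₀ (-x) (-y - -x) = kbar₀ x (y - x) := by
  rw [kbar₀_eq, kbar₀_eq, ← bosonKernel_neg, neg_div, neg_div, Real.cosh_neg, Real.cosh_neg]
  congr 3
  ring

lemma measurable_kbar₀ : Measurable fun p : ℝ × ℝ => kbar₀ p.1 (p.2 - p.1) := by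
  have := measurable_bosonKernel
  simp only [kbar₀_eq]
  fun_prop

lemma integrable_pow_mul_kbar₀ (i : ℕ) (x : ℝ) :
    Integrable fun y => (y - x) ^ i * kbar₀ x (y - x) := by
  refine (((integrable_bosonBound i).comp_sub_right x).mul_const (Real.cosh (x / 2))).mono'
    ?_ (.of_forall fun y => ?_)
  · exact (((measurable_id.sub_const x).pow_const i).mul
      (measurable_kbar₀.comp measurable_prodMk_left)).aestronglyMeasurable
  · have hratio : 0 ≤ Real.cosh (x / 2) / Real.cosh (y / 2) := by positivity
    rw [kbar₀_eq, mul_div_assoc, ← mul_assoc, norm_mul, Real.norm_eq_abs,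
      Real.norm_of_nonneg hratio]
    exact mul_le_mul (abs_pow_mul_bosonKernel_le i _)
      (div_le_self (by positivity) (Real.one_le_cosh _)) hratio (bosonBound_nonneg _ _)

/-- The moments `∫ (y - x)ⁱ kbar₀ x (y - x) dy` of the dimensionless kernel. Up to powers of the
temperature and constants, the rates `Γ₀`, `Γ₁`, `Γ₂` are the moments of order `0`, `1`, `2`. -/
noncomputable def moment (i : ℕ) (x : ℝ) : ℝ := ∫ y, (y - x) ^ i * kbar₀ x (y - x)

lemma measurable_moment (i : ℕ) : Measurable (moment i) := by
  have hint : Measurable fun p : ℝ × ℝ => (p.2 - p.1) ^ i * kbar₀ p.1 (p.2 - p.1) :=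
    ((measurable_snd.sub measurable_fst).pow_const i).mul measurable_kbar₀
  exact (hint.stronglyMeasurable.integral_prod_right' (ν := volume)).measurable

lemma integrable_kbar₀ (x : ℝ) : Integrable fun y => kbar₀ x (y - x) := by
  simpa using integrable_pow_mul_kbar₀ 0 x

lemma moment_zero_eq (x : ℝ) : moment 0 x = ∫ y, kbar₀ x (y - x) := by
  simp [moment]

lemma moment_zero_neg (x : ℝ) : moment 0 (-x) = moment 0 x := by
  rw [moment_zero_eq, moment_zero_eq, ← integral_neg_eq_self]
  simp only [kbar₀_neg]

lemma moment_zero_le (x : ℝ) : moment 0 x ≤ (∫ z, bosonKernel z) * Real.cosh (x / 2) := by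
  rw [moment_zero_eq, ← integral_sub_right_eq_self bosonKernel x, ← integral_mul_const]
  refine integral_mono (integrable_kbar₀ x)
    ((integrable_bosonKernel.comp_sub_right x).mul_const _) fun y => ?_
  simp only [kbar₀_eq]
  exact div_le_self (mul_nonneg (bosonKernel_nonneg _) (by positivity)) (Real.one_le_cosh _)

lemma le_moment_zero_of_nonneg {x : ℝ} (hx : 0 ≤ x) :
    Real.exp (-1) / 6 * (x + 1) ^ 3 ≤ moment 0 x := by
  have hint : ∫ y in (-1)..x, Real.exp (-1) / 2 * (y - x) ^ 2 =
      Real.exp (-1) / 6 * (x + 1) ^ 3 := by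
    rw [intervalIntegral.integral_const_mul,
      intervalIntegral.integral_comp_sub_right (fun z : ℝ => z ^ 2) x, integral_pow]
    norm_num
    ring
  rw [← hint, moment_zero_eq, intervalIntegral.integral_of_le (by linarith)]
  refine (setIntegral_mono_on ?_ (integrable_kbar₀ x).integrableOn measurableSet_Ioc
    fun y hy => ?_).trans (setIntegral_le_integral (integrable_kbar₀ x)
      (.of_forall fun y => kbar₀_nonneg x y))
  · exact (Continuous.integrableOn_Icc (by fun_prop)).mono_set Set.Ioc_subset_Icc_self
  · have hexp : Real.exp (-1) ≤ Real.exp ((|x| - |y| - |y - x|) / 2) := by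
      rw [abs_of_nonneg hx, abs_of_nonpos (sub_nonpos.2 hy.2)]
      gcongr
      rcases abs_cases y with ⟨h, -⟩ | ⟨h, -⟩ <;> linarith [hy.1]
    calc Real.exp (-1) / 2 * (y - x) ^ 2 = (y - x) ^ 2 / 2 * Real.exp (-1) := by ring
      _ ≤ _ := (mul_le_mul_of_nonneg_left hexp (by positivity)).trans (le_kbar₀ x y)

lemma le_moment_zero (x : ℝ) : Real.exp (-1) / 6 * (|x| + 1) ^ 3 ≤ moment 0 x := by
  rcases abs_choice x with h | h
  · simpa only [h] using le_moment_zero_of_nonneg (h ▸ abs_nonneg x)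
  · rw [h, ← moment_zero_neg]
    exact le_moment_zero_of_nonneg (h ▸ abs_nonneg x)

lemma moment_zero_pos (x : ℝ) : 0 < moment 0 x :=
  lt_of_lt_of_le (by positivity) (le_moment_zero x)

lemma moment_two_pos (x : ℝ) : 0 < moment 2 x := by
  rw [moment, integral_pos_iff_support_of_nonneg
    (fun y => mul_nonneg (sq_nonneg _) (kbar₀_nonneg x y)) (integrable_pow_mul_kbar₀ 2 x)]
  refine lt_of_lt_of_le (b := volume (Set.Ioi x)) (by simp) (measure_mono fun y hy => ?_)
  have hyx : 0 < y - x := sub_pos.2 hy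
  exact (mul_pos (sq_pos_of_pos hyx) (lt_of_lt_of_le (by positivity) (le_kbar₀ x y))).ne'

/-- The kernel `(y - x)ⁱ kbar₀ x (y - x) / moment 0 x` conjugated with `groundState`, which makes it
symmetric for even `i` and skew for odd `i`. Up to constants and the scaling `x = ε / T`,
`y = u / T`, the map `φ ↦ φ √(w Γ₀)` from `L²(dσ)` onto `L²(ℝ)` takes the integral operators with
kernels `K₀`, `K₁`, `K₂` to those with kernels `symmKernel 0`, `symmKernel 1`, `symmKernel 2`. -/
noncomputable def symmKernel (i : ℕ) (x y : ℝ) : ℝ :=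
  (y - x) ^ i * bosonKernel (y - x) / (√(moment 0 x) * √(moment 0 y))

/-- The square root of the density `w Γ₀` of `dσ`, up to a constant and the scaling `x = ε / T`: the
image in `L²(ℝ)` of the constant function `1`. -/
noncomputable def groundState (x : ℝ) : ℝ := √(moment 0 x) / (2 * Real.cosh (x / 2))

/-- The image in `L²(ℝ)` of the inhomogeneity `1 / Γ₀`, up to a constant and the scaling
`x = ε / T`. -/
noncomputable def source (x : ℝ) : ℝ := 1 / (2 * Real.cosh (x / 2) * √(moment 0 x))

lemma sqrt_moment_zero_pos (x : ℝ) : 0 < √(moment 0 x) := Real.sqrt_pos.2 (moment_zero_pos x)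

lemma sq_sqrt_moment_zero (x : ℝ) : √(moment 0 x) ^ 2 = moment 0 x :=
  Real.sq_sqrt (moment_zero_pos x).le

lemma groundState_pos (x : ℝ) : 0 < groundState x :=
  div_pos (sqrt_moment_zero_pos x) (by positivity)

lemma measurable_groundState : Measurable groundState := by
  have := measurable_moment 0
  unfold groundState
  fun_prop

lemma measurable_source : Measurable source := by
  have := measurable_moment 0
  unfold source
  fun_prop

lemma measurable_symmKernel (i : ℕ) : Measurable (Function.uncurry (symmKernel i)) := by
  have := measurable_moment 0
  have := measurable_bosonKernel
  unfold symmKernel Function.uncurry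
  fun_prop

lemma symmKernel_swap (i : ℕ) (x y : ℝ) : symmKernel i y x = (-1) ^ i * symmKernel i x y := by
  rw [symmKernel, symmKernel, ← neg_sub y x, bosonKernel_neg, neg_pow]
  ring

lemma symmKernel_mul_groundState (i : ℕ) (x y : ℝ) :
    symmKernel i x y * groundState y =
      (y - x) ^ i * kbar₀ x (y - x) * (groundState x / moment 0 x) := by
  have hx := sqrt_moment_zero_pos x
  have hy := sqrt_moment_zero_pos y
  rw [kbar₀_eq, ← sq_sqrt_moment_zero, symmKernel, groundState, groundState]
  field_simp

lemma intOp_symmKernel_groundState (i : ℕ) (x : ℝ) :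
    intOp volume (symmKernel i) groundState x = moment i x * (groundState x / moment 0 x) := by
  simp only [intOp, symmKernel_mul_groundState, integral_mul_const, moment]

lemma groundState_sq (x : ℝ) : groundState x ^ 2 = w 1 x * moment 0 x := by
  rw [groundState, div_pow, sq_sqrt_moment_zero, w_eq, div_one]
  ring

lemma groundState_mul_source (x : ℝ) : groundState x * source x = w 1 x := by
  have hx := sqrt_moment_zero_pos x
  rw [groundState, source, w_eq, div_one]
  field_simp
  norm_num

lemma source_sq (x : ℝ) : source x ^ 2 = w 1 x / moment 0 x := by
  rw [source, div_pow, mul_pow, sq_sqrt_moment_zero, w_eq, div_one]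
  ring

lemma w_nonneg (T ε : ℝ) : 0 ≤ w T ε := by
  rw [w_eq]
  positivity

lemma memLp_groundState : MemLp groundState 2 := by
  rw [memLp_two_iff_integrable_sq measurable_groundState.aestronglyMeasurable]
  refine (integrable_inv_cosh.const_mul (∫ z, bosonKernel z)).mono'
    (measurable_groundState.pow_const 2).aestronglyMeasurable (.of_forall fun x => ?_)
  have hI := integral_bosonKernel_pos
  rw [Real.norm_of_nonneg (sq_nonneg _), groundState_sq]
  calc w 1 x * moment 0 x ≤ w 1 x * ((∫ z, bosonKernel z) * Real.cosh (x / 2)) :=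
        mul_le_mul_of_nonneg_left (moment_zero_le x) (w_nonneg 1 x)
    _ = (∫ z, bosonKernel z) * (Real.cosh (x / 2))⁻¹ * (1 / 4) := by
        rw [w_eq, div_one]
        field_simp
    _ ≤ (∫ z, bosonKernel z) * (Real.cosh (x / 2))⁻¹ :=
        mul_le_of_le_one_right (by positivity) (by norm_num)

lemma exp_neg_one_div_six_le_moment_zero (x : ℝ) : Real.exp (-1) / 6 ≤ moment 0 x :=
  (le_mul_of_one_le_right (by positivity) (one_le_pow₀ (by linarith [abs_nonneg x]))).trans
    (le_moment_zero x)

lemma memLp_source : MemLp source 2 := by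
  rw [memLp_two_iff_integrable_sq measurable_source.aestronglyMeasurable]
  refine (integrable_w_one.div_const (Real.exp (-1) / 6)).mono'
    (measurable_source.pow_const 2).aestronglyMeasurable (.of_forall fun x => ?_)
  rw [Real.norm_of_nonneg (sq_nonneg _), source_sq]
  exact div_le_div_of_nonneg_left (w_nonneg 1 x) (by positivity)
    (exp_neg_one_div_six_le_moment_zero x)

lemma le_sqrt_moment_zero_mul_sqrt_moment_zero (x y : ℝ) :
    Real.exp (-1) / 6 * (|y| + 1) ≤ √(moment 0 x) * √(moment 0 y) := by
  set a := Real.exp (-1) / 6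
  have : 0 < a := by positivity
  rw [← Real.sqrt_mul (moment_zero_pos x).le]
  refine Real.le_sqrt_of_sq_le ?_
  calc (a * (|y| + 1)) ^ 2 = a * (a * (|y| + 1) ^ 2) := by ring
    _ ≤ a * (a * (|y| + 1) ^ 3) := by
        gcongr
        · linarith [abs_nonneg y]
        · norm_num
    _ ≤ moment 0 x * moment 0 y :=
        mul_le_mul (exp_neg_one_div_six_le_moment_zero x) (le_moment_zero y) (by positivity)
          (moment_zero_pos x).le

lemma abs_symmKernel_le (i : ℕ) (x y : ℝ) :
    |symmKernel i x y| ≤ bosonBound i (y - x) / (Real.exp (-1) / 6 * (|y| + 1)) := by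
  rw [symmKernel, abs_div, abs_of_pos (mul_pos (sqrt_moment_zero_pos x) (sqrt_moment_zero_pos y))]
  exact div_le_div₀ (bosonBound_nonneg _ _) (abs_pow_mul_bosonKernel_le i _) (by positivity)
    (le_sqrt_moment_zero_mul_sqrt_moment_zero x y)

lemma isSchurKernel_symmKernel (i : ℕ) :
    IsSchurKernel volume (symmKernel i) (∫ z, bosonBound i z / (Real.exp (-1) / 6)) := by
  refine .of_abs_le_sub (measurable_symmKernel i) (fun x y => (abs_symmKernel_le i x y).trans ?_)
    ((integrable_bosonBound i).div_const _) ?_ le_rfl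
  · exact div_le_div_of_nonneg_left (bosonBound_nonneg _ _) (by positivity)
      (le_mul_of_one_le_right (by positivity) (by linarith [abs_nonneg y]))
  · simpa only [div_eq_mul_inv] using (memLp_bosonBound i).mul_const _

lemma exists_isSchurKernel_indicator_symmKernel :
    ∃ R : ℝ, IsSchurKernel volume
      (fun x => (Set.Icc (-R) R)ᶜ.indicator (symmKernel 0 x)) (1 / 2) := by
  set a := Real.exp (-1) / 6
  set I := ∫ z, bosonBound 0 z
  have ha : 0 < a := by positivity
  have hI : 0 ≤ I := integral_nonneg (bosonBound_nonneg 0)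
  have haR : a * (2 * I / a + 1) = 2 * I + a := by field_simp
  refine ⟨2 * I / a + 1, .of_abs_le_sub (k := fun z => bosonBound 0 z / (2 * I + a)) ?_
    (fun x y => ?_) ((integrable_bosonBound 0).div_const _) ?_ ?_⟩
  · exact (measurable_symmKernel 0).indicator (measurable_snd measurableSet_Icc.compl)
  · by_cases hy : y ∈ Set.Icc (-(2 * I / a + 1)) (2 * I / a + 1)
    · rw [Set.indicator_of_notMem (Set.notMem_compl_iff.2 hy), abs_zero]
      exact div_nonneg (bosonBound_nonneg 0 (y - x)) (by positivity)
    · rw [Set.indicator_of_mem (Set.mem_compl hy)]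
      refine (abs_symmKernel_le 0 x y).trans ?_
      rw [Set.mem_Icc, ← abs_le, not_le] at hy
      rw [← haR]
      gcongr
      · exact bosonBound_nonneg _ _
      · linarith
  · simpa only [div_eq_mul_inv] using (memLp_bosonBound 0).mul_const _
  · rw [integral_div, div_le_iff₀ (by positivity)]
    linarith

lemma isGroundState_groundState : IsGroundState volume (symmKernel 0) groundState where
  kernel_nonneg x y := by
    rw [symmKernel, pow_zero, one_mul]
    exact div_nonneg (bosonKernel_nonneg _) (by positivity)
  kernel_symm x y := by simpa using symmKernel_swap 0 x y
  measurable := measurable_groundState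
  pos := groundState_pos
  memLp := memLp_groundState
  fixed x := by
    rw [intOp_symmKernel_groundState, mul_div_cancel₀ _ (moment_zero_pos x).ne']

lemma le_doobKernel (x y : ℝ) :
    bosonKernel (y - x) / ((∫ z, bosonKernel z) * Real.cosh (x / 2)) ≤
      doobKernel (symmKernel 0) groundState x y := by
  have hx := sqrt_moment_zero_pos x
  have hy := sqrt_moment_zero_pos y
  have hI := integral_bosonKernel_pos
  have hdoob : doobKernel (symmKernel 0) groundState x y =
      bosonKernel (y - x) * Real.cosh (y / 2) / (Real.cosh (x / 2) * moment 0 y) := by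
    rw [doobKernel, symmKernel, groundState, groundState]
    conv_rhs => rw [← sq_sqrt_moment_zero y]
    field_simp
  rw [hdoob, div_le_div_iff₀ (by positivity) (mul_pos (by positivity) (moment_zero_pos y))]
  have hbose : 0 ≤ bosonKernel (y - x) * Real.cosh (x / 2) :=
    mul_nonneg (bosonKernel_nonneg _) (by positivity)
  linarith [mul_le_mul_of_nonneg_left (moment_zero_le y) hbose]

lemma exists_pos_le_doobKernel (R : ℝ) :
    ∃ c > 0, ∀ x ∈ Set.Icc (R + 1) (R + 2), ∀ y ∈ Set.Icc (-R) R,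
      c ≤ doobKernel (symmKernel 0) groundState x y := by
  have hI := integral_bosonKernel_pos
  refine ⟨Real.exp (-(R + 1)) / ((∫ z, bosonKernel z) * Real.exp (|R| / 2 + 1)), by positivity,
    fun x hx y hy => (div_le_div₀ (bosonKernel_nonneg _) ?_ (by positivity) ?_).trans
      (le_doobKernel x y)⟩
  · refine le_trans ?_ (le_bosonKernel _)
    have hsq : 1 ≤ (y - x) ^ 2 := by nlinarith [hx.1, hy.2]
    have hexp : Real.exp (-(R + 1)) ≤ Real.exp (-(|y - x| / 2)) := by
      rw [abs_of_nonpos (by linarith [hx.1, hy.2])]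
      gcongr
      linarith [hx.2, hy.1]
    nlinarith [Real.exp_pos (-(|y - x| / 2))]
  · gcongr
    refine (cosh_le_exp_abs _).trans (Real.exp_le_exp.2 ?_)
    rw [abs_of_nonneg] <;> rcases abs_cases R with h | h <;> linarith [hx.1, hx.2, hy.1, hy.2]

/-- The operator on `L²(ℝ)` with kernel `symmKernel i`. -/
noncomputable def symmOp (i : ℕ) : Lp ℝ 2 (volume : Measure ℝ) →L[ℝ] Lp ℝ 2 (volume : Measure ℝ) :=
  (isSchurKernel_symmKernel i).toCLM

/-- The function `groundState` as an element of `L²(ℝ)`. -/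
noncomputable def groundVec : Lp ℝ 2 (volume : Measure ℝ) := memLp_groundState.toLp

/-- The function `source` as an element of `L²(ℝ)`. -/
noncomputable def sourceVec : Lp ℝ 2 (volume : Measure ℝ) := memLp_source.toLp

lemma inner_groundVec_sourceVec : ⟪groundVec, sourceVec⟫ = 1 := by
  rw [groundVec, sourceVec, inner_toLp_toLp]
  simpa only [groundState_mul_source] using integral_w_one

lemma inner_symmOp (i : ℕ) (F G : Lp ℝ 2 (volume : Measure ℝ)) :
    ⟪symmOp i F, G⟫ = (-1) ^ i * ⟪F, symmOp i G⟫ :=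
  (isSchurKernel_symmKernel i).inner_toCLM_swap (symmKernel_swap i) F G

lemma inner_groundVec_symmOp_two_pos : 0 < ⟪groundVec, symmOp 2 groundVec⟫ := by
  have hM := (isSchurKernel_symmKernel 2).memLp_intOp memLp_groundState
  have hpos (x : ℝ) : 0 < groundState x * intOp volume (symmKernel 2) groundState x := by
    rw [intOp_symmKernel_groundState]
    exact mul_pos (groundState_pos x)
      (mul_pos (moment_two_pos x) (div_pos (groundState_pos x) (moment_zero_pos x)))
  rw [groundVec, symmOp, IsSchurKernel.toCLM_toLp, inner_toLp_toLp,
    integral_pos_iff_support_of_nonneg (fun x => (hpos x).le) (memLp_groundState.integrable_mul hM),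
    Set.eq_univ_of_forall fun x => Function.mem_support.2 (hpos x).ne']
  simp

lemma exists_hasSpectralGap_symmOp : ∃ q, HasSpectralGap (symmOp 0) groundVec q := by
  obtain ⟨R, htail⟩ := exists_isSchurKernel_indicator_symmKernel
  obtain ⟨c, hc₀, hc⟩ := exists_pos_le_doobKernel R
  exact isGroundState_groundState.exists_hasSpectralGap_toCLM (isSchurKernel_symmKernel 0)
    measurableSet_Icc (by simp) (by simp) measurableSet_Icc hc₀ hc htail

lemma exists_isGappedPerturbation_symmOp (a : ℝ) {b : ℝ} (hb : 0 < b) :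
    ∃ q, IsGappedPerturbation (symmOp 0) (a • symmOp 1) (b • symmOp 2) groundVec q := by
  obtain ⟨q, hgap⟩ := exists_hasSpectralGap_symmOp
  refine ⟨q, hgap, fun F G => ?_, fun F G => ?_, ?_⟩
  · simp [real_inner_smul_left, real_inner_smul_right, inner_symmOp 1]
  · simp [real_inner_smul_left, real_inner_smul_right, inner_symmOp 2]
  · simpa [real_inner_smul_right] using mul_pos hb inner_groundVec_symmOp_two_pos

end Bloch

section Dilation

variable {T : ℝ}

lemma integral_const_mul_comp_div (hT : 0 < T) (g : ℝ → ℝ) (c : ℝ) :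
    ∫ u, c * g (u / T) = c * T * ∫ y, g y := by
  rw [integral_const_mul, Measure.integral_comp_div, abs_of_pos hT, smul_eq_mul, mul_assoc]

lemma integrable_const_mul_comp_div (hT : T ≠ 0) {g : ℝ → ℝ} (hg : Integrable g) (c : ℝ) :
    Integrable fun u => c * g (u / T) := (hg.comp_div hT).const_mul c

lemma measurableEmbedding_div (hT : T ≠ 0) : MeasurableEmbedding fun x : ℝ => x / T := by
  simpa only [div_eq_mul_inv] using measurableEmbedding_mulRight₀ (inv_ne_zero hT)

lemma map_div_volume (hT : T ≠ 0) :
    Measure.map (fun x : ℝ => x / T) volume = ENNReal.ofReal |T| • volume := by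
  simpa only [div_eq_mul_inv, inv_inv] using Real.map_volume_mul_right (inv_ne_zero hT)

lemma ae_comp_div_iff (hT : T ≠ 0) {p : ℝ → Prop} : (∀ᵐ ε, p (ε / T)) ↔ ∀ᵐ x, p x := by
  rw [← (measurableEmbedding_div hT).ae_map_iff, map_div_volume hT,
    Measure.ae_ennreal_smul_measure_iff (ENNReal.ofReal_pos.2 (abs_pos.2 hT)).ne']

lemma memLp_comp_div (hT : T ≠ 0) {f : ℝ → ℝ} {p : ENNReal} (hf : MemLp f p) :
    MemLp (fun ε => f (ε / T)) p := by
  refine (measurableEmbedding_div hT).memLp_map_measure_iff.1 ?_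
  rw [map_div_volume hT]
  exact hf.smul_measure ENNReal.ofReal_ne_top

lemma memLp_comp_div_iff (hT : T ≠ 0) {f : ℝ → ℝ} {p : ENNReal} :
    MemLp (fun ε => f (ε / T)) p ↔ MemLp f p := by
  refine ⟨fun h => ?_, memLp_comp_div hT⟩
  simpa [div_inv_eq_mul, hT] using memLp_comp_div (inv_ne_zero hT) h

end Dilation

lemma memLp_two_withDensity_sq_iff {α : Type*} [MeasurableSpace α] {μ : Measure α} {f g : α → ℝ}
    (hg : Measurable g) (hg₀ : ∀ x, 0 < g x) :
    MemLp f 2 (μ.withDensity fun x => ENNReal.ofReal (g x ^ 2)) ↔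
      MemLp (fun x => g x * f x) 2 μ := by
  have hd : Measurable fun x => (g x ^ 2).toNNReal := (hg.pow_const 2).real_toNNReal
  have hmeas (n : ℕ) :
      AEStronglyMeasurable (fun x => g x ^ n * f x) μ ↔ AEStronglyMeasurable f μ :=
    ⟨fun h => (h.aemeasurable.div (hg.pow_const n).aemeasurable).aestronglyMeasurable.congr
      (.of_forall fun x => mul_div_cancel_left₀ _ (pow_pos (hg₀ x) n).ne'),
      (hg.pow_const n).aestronglyMeasurable.mul⟩
  have hmeas_density : AEStronglyMeasurable f (μ.withDensity fun x => ENNReal.ofReal (g x ^ 2)) ↔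
      AEStronglyMeasurable f μ := by
    refine (aestronglyMeasurable_withDensity_iff hd).trans ?_
    simpa only [Real.coe_toNNReal _ (sq_nonneg _), smul_eq_mul] using hmeas 2
  have hint : Integrable (fun x => f x ^ 2) (μ.withDensity fun x => ENNReal.ofReal (g x ^ 2)) ↔
      Integrable (fun x => (g x * f x) ^ 2) μ := by
    refine (integrable_withDensity_iff_integrable_smul hd).trans (iff_of_eq ?_)
    simp only [NNReal.smul_def, Real.coe_toNNReal _ (sq_nonneg _), smul_eq_mul, mul_pow]
  constructor <;> intro h
  · have hf := hmeas_density.1 h.aestronglyMeasurable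
    exact (memLp_two_iff_integrable_sq (hg.aestronglyMeasurable.mul hf)).2 (hint.1 h.integrable_sq)
  · have hf := (hmeas 1).1 (by simpa using h.aestronglyMeasurable)
    exact (memLp_two_iff_integrable_sq (hmeas_density.2 hf)).2 (hint.2 h.integrable_sq)

namespace Bloch

variable {ω₀ εF T : ℝ}

lemma Kbar₀_eq (ω₀ T ε u : ℝ) : Kbar₀ ω₀ T ε u = (T / ω₀) ^ 2 *
    ((u / T - ε / T) ^ 0 * kbar₀ (ε / T) (u / T - ε / T)) := by
  rw [Kbar₀, sub_div]; ring

lemma Kbar₁_eq (hω₀ : ω₀ ≠ 0) (εF T ε u : ℝ) : Kbar₁ ω₀ εF T ε u =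
    (2 * εF)⁻¹ * T * (T / ω₀) ^ 2 *
      ((u / T - ε / T) ^ 1 * kbar₀ (ε / T) (u / T - ε / T)) := by
  rw [Kbar₁, Kbar₀, sub_div]; field_simp

lemma Kbar₂_eq (ω₀ T ε u : ℝ) : Kbar₂ ω₀ T ε u =
    (2 * ω₀ ^ 2)⁻¹ * T ^ 2 * (T / ω₀) ^ 2 *
      ((u / T - ε / T) ^ 2 * kbar₀ (ε / T) (u / T - ε / T)) := by
  rw [Kbar₂, Kbar₀, sub_div]; field_simp

lemma integrable_Kbar₀ (hT : T ≠ 0) (ε : ℝ) : Integrable (Kbar₀ ω₀ T ε) :=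
  (integrable_const_mul_comp_div hT (integrable_pow_mul_kbar₀ 0 (ε / T)) _).congr
    (.of_forall fun u => (Kbar₀_eq ω₀ T ε u).symm)

lemma integrable_Kbar₁ (hω₀ : ω₀ ≠ 0) (hT : T ≠ 0) (ε : ℝ) : Integrable (Kbar₁ ω₀ εF T ε) :=
  (integrable_const_mul_comp_div hT (integrable_pow_mul_kbar₀ 1 (ε / T)) _).congr
    (.of_forall fun u => (Kbar₁_eq hω₀ εF T ε u).symm)

lemma integrable_Kbar₂ (hT : T ≠ 0) (ε : ℝ) : Integrable (Kbar₂ ω₀ T ε) :=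
  (integrable_const_mul_comp_div hT (integrable_pow_mul_kbar₀ 2 (ε / T)) _).congr
    (.of_forall fun u => (Kbar₂_eq ω₀ T ε u).symm)

lemma Γ₀_eq (hT : 0 < T) (ε : ℝ) : Γ₀ ω₀ T ε = T ^ 3 / ω₀ ^ 2 * moment 0 (ε / T) := by
  simp only [Γ₀, Kbar₀_eq]
  rw [integral_const_mul_comp_div hT fun y => (y - ε / T) ^ 0 * kbar₀ (ε / T) (y - ε / T), moment]
  ring

lemma Γ₁_eq (hω₀ : ω₀ ≠ 0) (hT : 0 < T) (ε : ℝ) :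
    Γ₁ ω₀ εF T ε = (2 * εF)⁻¹ * (T ^ 4 / ω₀ ^ 2) * moment 1 (ε / T) := by
  simp only [Γ₁, Kbar₁_eq hω₀]
  rw [integral_const_mul_comp_div hT fun y => (y - ε / T) ^ 1 * kbar₀ (ε / T) (y - ε / T), moment]
  ring

lemma Γ₂_eq (hT : 0 < T) (ε : ℝ) :
    Γ₂ ω₀ T ε = (2 * ω₀ ^ 2)⁻¹ * (T ^ 5 / ω₀ ^ 2) * moment 2 (ε / T) := by
  simp only [Γ₂, Kbar₂_eq]
  rw [integral_const_mul_comp_div hT fun y => (y - ε / T) ^ 2 * kbar₀ (ε / T) (y - ε / T), moment]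
  ring

lemma Γ₀_pos (hω₀ : ω₀ ≠ 0) (hT : 0 < T) (ε : ℝ) : 0 < Γ₀ ω₀ T ε := by
  have := moment_zero_pos (ε / T)
  rw [Γ₀_eq hT]
  positivity

lemma w_eq_groundState_mul_source (T ε : ℝ) : w T ε = groundState (ε / T) * source (ε / T) := by
  rw [groundState_mul_source, w_eq, w_eq, div_one]

lemma source_eq_groundState_div (x : ℝ) : source x = groundState x / moment 0 x := by
  have := sqrt_moment_zero_pos x
  rw [source, groundState]
  nth_rw 3 [← sq_sqrt_moment_zero]
  field_simp

lemma integral_w (hT : 0 < T) : ∫ ε, w T ε = T := by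
  have hw (ε : ℝ) : w T ε = 1 * w 1 (ε / T) := by rw [w_eq, w_eq, div_one, one_mul]
  simp only [hw]
  rw [integral_const_mul_comp_div hT, integral_w_one, one_mul, mul_one]

lemma pow_mul_kbar₀_eq (i : ℕ) (x y : ℝ) : (y - x) ^ i * kbar₀ x (y - x) =
    symmKernel i x y * groundState y * moment 0 x / groundState x := by
  have he := groundState_pos x
  have hm := moment_zero_pos x
  rw [symmKernel_mul_groundState]
  field_simp

lemma K₀_eq (hω₀ : ω₀ ≠ 0) (hT : 0 < T) (ε u : ℝ) : K₀ ω₀ T ε u =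
    (T * groundState (ε / T))⁻¹ * (symmKernel 0 (ε / T) (u / T) * groundState (u / T)) := by
  have he := groundState_pos (ε / T)
  have hm := moment_zero_pos (ε / T)
  rw [K₀, Γ₀_eq hT, Kbar₀_eq, pow_mul_kbar₀_eq]
  field_simp

lemma K₁_eq (hω₀ : ω₀ ≠ 0) (hT : 0 < T) (ε u : ℝ) : K₁ ω₀ εF T ε u =
    (T * groundState (ε / T))⁻¹ *
      (T * (2 * εF)⁻¹ * symmKernel 1 (ε / T) (u / T) * groundState (u / T)) := by
  have he := groundState_pos (ε / T)
  have hm := moment_zero_pos (ε / T)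
  rw [K₁, Γ₀_eq hT, Kbar₁_eq hω₀, pow_mul_kbar₀_eq]
  field_simp

lemma K₂_eq (hω₀ : ω₀ ≠ 0) (hT : 0 < T) (ε u : ℝ) : K₂ ω₀ T ε u =
    (T * groundState (ε / T))⁻¹ *
      (T ^ 2 * (2 * ω₀ ^ 2)⁻¹ * symmKernel 2 (ε / T) (u / T) * groundState (u / T)) := by
  have he := groundState_pos (ε / T)
  have hm := moment_zero_pos (ε / T)
  rw [K₂, Γ₀_eq hT, Kbar₂_eq, pow_mul_kbar₀_eq]
  field_simp

/-- The first-order term of the symmetrized collision operator in powers of `T`. -/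
noncomputable def firstOrderOp (εF : ℝ) :
    Lp ℝ 2 (volume : Measure ℝ) →L[ℝ] Lp ℝ 2 (volume : Measure ℝ) := (2 * εF)⁻¹ • symmOp 1

/-- The second-order term of the symmetrized collision operator in powers of `T`, up to sign. -/
noncomputable def secondOrderOp (ω₀ : ℝ) :
    Lp ℝ 2 (volume : Measure ℝ) →L[ℝ] Lp ℝ 2 (volume : Measure ℝ) := (2 * ω₀ ^ 2)⁻¹ • symmOp 2

/-- The operator `1 - K` in the symmetrized picture. -/
noncomputable def collisionOp (ω₀ εF T : ℝ) :
    Lp ℝ 2 (volume : Measure ℝ) →L[ℝ] Lp ℝ 2 (volume : Measure ℝ) :=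
  perturbedOp (symmOp 0) (firstOrderOp εF) (secondOrderOp ω₀) T

/-- The coefficient of `T⁵` in `ω₀² / φ₊(T)`. -/
noncomputable def rateCoeff (ω₀ εF : ℝ) : ℝ :=
  secondOrderRate (symmOp 0) (firstOrderOp εF) (secondOrderOp ω₀) groundVec

lemma exists_isGappedPerturbation (hω₀ : ω₀ ≠ 0) (εF : ℝ) : ∃ q,
    IsGappedPerturbation (symmOp 0) (firstOrderOp εF) (secondOrderOp ω₀) groundVec q :=
  exists_isGappedPerturbation_symmOp _ (by positivity)

lemma rateCoeff_pos (hω₀ : ω₀ ≠ 0) (εF : ℝ) : 0 < rateCoeff ω₀ εF :=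
  (exists_isGappedPerturbation hω₀ εF).choose_spec.secondOrderRate_pos

/-- The image of `(K₀)^m (Γ₁ / Γ₀)` in the symmetrized picture, up to a constant factor. -/
noncomputable def symmIter (m : ℕ) : ℝ → ℝ :=
  (intOp volume (symmKernel 0))^[m] (intOp volume (symmKernel 1) groundState)

lemma symmIter_succ (m : ℕ) : symmIter (m + 1) = intOp volume (symmKernel 0) (symmIter m) :=
  Function.iterate_succ_apply' ..

lemma memLp_symmIter (m : ℕ) : MemLp (symmIter m) 2 := by
  induction m with
  | zero => exact (isSchurKernel_symmKernel 1).memLp_intOp memLp_groundState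
  | succ m ih => rw [symmIter_succ]; exact (isSchurKernel_symmKernel 0).memLp_intOp ih

lemma toLp_symmIter (m : ℕ) :
    (memLp_symmIter m).toLp = (symmOp 0 ^ m) (symmOp 1 groundVec) := by
  induction m with
  | zero => exact ((isSchurKernel_symmKernel 1).toCLM_toLp memLp_groundState).symm
  | succ m ih =>
    rw [pow_succ', mul_apply_eq_comp, ← ih, symmOp, IsSchurKernel.toCLM_toLp]
    simp only [symmIter_succ]

lemma iter_eq (hω₀ : ω₀ ≠ 0) (hT : 0 < T) (m : ℕ) (ε : ℝ) :
    iter ω₀ εF T m ε = (2 * εF)⁻¹ * T * (symmIter m (ε / T) / groundState (ε / T)) := by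
  have he := groundState_pos (ε / T)
  induction m generalizing ε with
  | zero =>
    have hm := moment_zero_pos (ε / T)
    change Γ₁ ω₀ εF T ε / Γ₀ ω₀ T ε = _ * (intOp volume (symmKernel 1) groundState _ / _)
    rw [Γ₁_eq hω₀ hT, Γ₀_eq hT, intOp_symmKernel_groundState]
    field_simp
  | succ m ih =>
    have hintegrand (u : ℝ) : K₀ ω₀ T ε u * iter ω₀ εF T m u =
        (2 * εF)⁻¹ / groundState (ε / T) * (symmKernel 0 (ε / T) (u / T) * symmIter m (u / T)) := by
      have hu := groundState_pos (u / T)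
      rw [ih u hu, K₀_eq hω₀ hT]
      field_simp
    rw [iter, Function.iterate_succ_apply', ← iter, K₀op]
    simp only [hintegrand]
    rw [integral_const_mul_comp_div hT fun y => symmKernel 0 (ε / T) y * symmIter m y,
      symmIter_succ, intOp]
    ring

lemma integrable_K₀_mul_iter (hω₀ : ω₀ ≠ 0) (hT : 0 < T) (m : ℕ) (ε : ℝ) :
    Integrable fun u => K₀ ω₀ T ε u * iter ω₀ εF T m u := by
  refine (integrable_const_mul_comp_div hT.ne' ((isSchurKernel_symmKernel 0).integrable_row_mul
    (memLp_symmIter m) (ε / T)) ((2 * εF)⁻¹ / groundState (ε / T))).congr (.of_forall fun u => ?_)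
  have he := groundState_pos (ε / T)
  have hu := groundState_pos (u / T)
  simp only
  rw [iter_eq hω₀ hT, K₀_eq hω₀ hT]
  field_simp

lemma Γ₂_mul_w (hT : 0 < T) (ε : ℝ) : Γ₂ ω₀ T ε * w T ε =
    (2 * ω₀ ^ 2)⁻¹ * (T ^ 5 / ω₀ ^ 2) *
      (groundState * intOp volume (symmKernel 2) groundState) (ε / T) := by
  rw [Γ₂_eq hT, w_eq_groundState_mul_source, source_eq_groundState_div, Pi.mul_apply,
    intOp_symmKernel_groundState]
  ring

lemma term_mul_w (hω₀ : ω₀ ≠ 0) (hT : 0 < T) (m : ℕ) (ε : ℝ) : term ω₀ εF T m ε * w T ε =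
    (2 * εF)⁻¹ ^ 2 * (T ^ 5 / ω₀ ^ 2) *
      (intOp volume (symmKernel 1) groundState * symmIter m) (ε / T) := by
  have he := groundState_pos (ε / T)
  rw [term, Γ₁_eq hω₀ hT, iter_eq hω₀ hT, w_eq_groundState_mul_source, source_eq_groundState_div,
    Pi.mul_apply, intOp_symmKernel_groundState]
  field_simp

lemma integrable_Γ₂_mul_w (hT : 0 < T) : Integrable fun ε => Γ₂ ω₀ T ε * w T ε := by
  simp only [Γ₂_mul_w hT]
  exact integrable_const_mul_comp_div hT.ne' (memLp_groundState.integrable_mul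
    ((isSchurKernel_symmKernel 2).memLp_intOp memLp_groundState)) _

lemma integrable_term_mul_w (hω₀ : ω₀ ≠ 0) (hT : 0 < T) (m : ℕ) :
    Integrable fun ε => term ω₀ εF T m ε * w T ε := by
  simp only [term_mul_w hω₀ hT]
  exact integrable_const_mul_comp_div hT.ne' (((isSchurKernel_symmKernel 1).memLp_intOp
    memLp_groundState).integrable_mul (memLp_symmIter m)) _

lemma avg_Γ₂ (hT : 0 < T) :
    avg T (Γ₂ ω₀ T) = T ^ 5 / ω₀ ^ 2 * ⟪groundVec, secondOrderOp ω₀ groundVec⟫ := by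
  have hinner : ⟪groundVec, symmOp 2 groundVec⟫ =
      ∫ x, (groundState * intOp volume (symmKernel 2) groundState) x := by
    rw [groundVec, symmOp, IsSchurKernel.toCLM_toLp, inner_toLp_toLp]
    rfl
  rw [avg, integral_w hT, secondOrderOp, smul_apply, real_inner_smul_right,
    hinner]
  simp only [Γ₂_mul_w hT]
  rw [integral_const_mul_comp_div hT]
  field_simp

lemma avg_term (hω₀ : ω₀ ≠ 0) (hT : 0 < T) (m : ℕ) : avg T (term ω₀ εF T m) =
    T ^ 5 / ω₀ ^ 2 * ⟪firstOrderOp εF groundVec, (symmOp 0 ^ m) (firstOrderOp εF groundVec)⟫ := by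
  have hinner : ⟪symmOp 1 groundVec, (symmOp 0 ^ m) (symmOp 1 groundVec)⟫ =
      ∫ x, (intOp volume (symmKernel 1) groundState * symmIter m) x := by
    rw [← toLp_symmIter, groundVec, symmOp, IsSchurKernel.toCLM_toLp, inner_toLp_toLp]
    rfl
  rw [avg, integral_w hT, firstOrderOp, smul_apply, map_smul,
    real_inner_smul_left, real_inner_smul_right, hinner]
  simp only [term_mul_w hω₀ hT]
  rw [integral_const_mul_comp_div hT]
  field_simp

lemma summable_avg_term (hω₀ : ω₀ ≠ 0) (hT : 0 < T) :
    Summable fun m => avg T (term ω₀ εF T m) := by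
  obtain ⟨q, h⟩ := exists_isGappedPerturbation hω₀ εF
  simp only [avg_term hω₀ hT]
  exact (h.hasSum_inner_pow h.inner_skew_fixed _).summable.mul_left _

lemma rate_eq (hω₀ : ω₀ ≠ 0) (hT : 0 < T) :
    rate ω₀ εF T = T ^ 5 / ω₀ ^ 2 * rateCoeff ω₀ εF := by
  simp only [rate, rateCoeff, secondOrderRate, avg_Γ₂ hT, avg_term hω₀ hT, tsum_mul_left, mul_add]

lemma rate_pos (hω₀ : ω₀ ≠ 0) (hT : 0 < T) : 0 < rate ω₀ εF T := by
  have := rateCoeff_pos hω₀ εF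
  rw [rate_eq hω₀ hT]
  positivity

lemma phiPlus_eq (hω₀ : ω₀ ≠ 0) (hT : 0 < T) :
    phiPlus ω₀ εF T = ω₀ ^ 2 / rateCoeff ω₀ εF / T ^ 5 := by
  rw [phiPlus, rate_eq hω₀ hT]
  field_simp

end Bloch

lemma isEquivalent_const_div_pow_of_tendsto {τ : ℝ → ℝ} {n : ℕ} {C : ℝ} (hC : C ≠ 0)
    (h : Tendsto (fun T => T ^ n * τ T) (𝓝[>] 0) (𝓝 C)) :
    τ ~[𝓝[>] 0] fun T => C / T ^ n := by
  have hpos : ∀ᶠ T in 𝓝[>] (0 : ℝ), T ^ n ≠ 0 := by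
    filter_upwards [self_mem_nhdsWithin] with T hT using (pow_pos hT n).ne'
  refine (isEquivalent_iff_tendsto_one (hpos.mono fun T hT => div_ne_zero hC hT)).2 ?_
  rw [← div_self hC]
  refine (h.div_const C).congr fun T => ?_
  rw [Pi.div_apply, div_div_eq_mul_div, mul_comm]

namespace Bloch

variable {ω₀ εF T : ℝ} {φ : ℝ → ℝ}

/-- The kernel `K` in the symmetrized picture. -/
noncomputable def symmCollisionKernel (ω₀ εF T x y : ℝ) : ℝ :=
  symmKernel 0 x y + T * (2 * εF)⁻¹ * symmKernel 1 x y - T ^ 2 * (2 * ω₀ ^ 2)⁻¹ * symmKernel 2 x y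

/-- The symmetrized picture of a function `φ` of the energy: `φ`, as a function of `ε / T`, times
a constant multiple of the square root of the density of `dσ`. The constant is chosen such that
`1 / Γ₀` turns into `source`. -/
noncomputable def symmetrize (ω₀ T : ℝ) (φ : ℝ → ℝ) (x : ℝ) : ℝ :=
  T ^ 3 / ω₀ ^ 2 * groundState x * φ (T * x)

/-- The inverse of `symmetrize`. -/
noncomputable def unsymmetrize (ω₀ T : ℝ) (F : ℝ → ℝ) (ε : ℝ) : ℝ :=
  F (ε / T) / (T ^ 3 / ω₀ ^ 2 * groundState (ε / T))

lemma symmetrize_div (hT : T ≠ 0) (ω₀ : ℝ) (φ : ℝ → ℝ) (ε : ℝ) :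
    symmetrize ω₀ T φ (ε / T) = T ^ 3 / ω₀ ^ 2 * groundState (ε / T) * φ ε := by
  rw [symmetrize, mul_div_cancel₀ _ hT]

lemma unsymmetrize_symmetrize (hω₀ : ω₀ ≠ 0) (hT : T ≠ 0) (φ : ℝ → ℝ) :
    unsymmetrize ω₀ T (symmetrize ω₀ T φ) = φ := by
  funext ε
  have he := groundState_pos (ε / T)
  rw [unsymmetrize, symmetrize_div hT]
  field_simp

lemma symmetrize_unsymmetrize (hω₀ : ω₀ ≠ 0) (hT : T ≠ 0) (F : ℝ → ℝ) :
    symmetrize ω₀ T (unsymmetrize ω₀ T F) = F := by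
  funext x
  have he := groundState_pos x
  rw [symmetrize, unsymmetrize, mul_div_cancel_left₀ _ hT]
  field_simp

lemma ae_eq_of_symmetrize_ae_eq (hω₀ : ω₀ ≠ 0) (hT : T ≠ 0) {ψ : ℝ → ℝ}
    (h : symmetrize ω₀ T ψ =ᵐ[volume] symmetrize ω₀ T φ) : ψ =ᵐ[volume] φ := by
  filter_upwards [(ae_comp_div_iff hT).2 h] with ε hε
  rw [← unsymmetrize_symmetrize hω₀ hT ψ, ← unsymmetrize_symmetrize hω₀ hT φ, unsymmetrize,
    unsymmetrize, hε]

lemma memLp_sigmaMeasure_iff (hω₀ : ω₀ ≠ 0) (hT : 0 < T) :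
    MemLp φ 2 (sigmaMeasure ω₀ T) ↔ MemLp (symmetrize ω₀ T φ) 2 := by
  set c := √(T ^ 3 / ω₀ ^ 2)
  have hc : 0 < c := by positivity
  have hc₂ : c ^ 2 = T ^ 3 / ω₀ ^ 2 := Real.sq_sqrt (by positivity)
  have hdensity (ε : ℝ) : w T ε * Γ₀ ω₀ T ε = (c * groundState (ε / T)) ^ 2 := by
    have hm := moment_zero_pos (ε / T)
    rw [w_eq_groundState_mul_source, source_eq_groundState_div, Γ₀_eq hT, mul_pow, hc₂]
    field_simp
  have hmeas : Measurable fun ε => c * groundState (ε / T) :=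
    (measurable_groundState.comp (measurable_id.div_const T)).const_mul c
  have hφ : (fun ε => symmetrize ω₀ T φ (ε / T)) =
      c • fun ε => c * groundState (ε / T) * φ ε := by
    funext ε
    rw [symmetrize_div hT.ne', ← hc₂, Pi.smul_apply, smul_eq_mul]
    ring
  simp only [sigmaMeasure, hdensity]
  rw [memLp_two_withDensity_sq_iff hmeas fun ε => mul_pos hc (groundState_pos _),
    ← memLp_comp_div_iff hT.ne' (f := symmetrize ω₀ T φ), hφ]
  refine ⟨fun h => h.const_smul c, fun h => ?_⟩
  simpa only [inv_smul_smul₀ hc.ne'] using h.const_smul c⁻¹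

lemma integrable_symmCollisionKernel_mul {F : ℝ → ℝ} (hF : MemLp F 2) (x : ℝ) :
    Integrable fun y => symmCollisionKernel ω₀ εF T x y * F y := by
  have hrow (i : ℕ) := (isSchurKernel_symmKernel i).integrable_row_mul hF x
  refine (((hrow 0).add ((hrow 1).const_mul (T * (2 * εF)⁻¹))).sub
    ((hrow 2).const_mul (T ^ 2 * (2 * ω₀ ^ 2)⁻¹))).congr (.of_forall fun y => ?_)
  simp only [symmCollisionKernel, Pi.add_apply, Pi.sub_apply]
  ring

lemma intOp_symmCollisionKernel {F : ℝ → ℝ} (hF : MemLp F 2) :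
    intOp volume (symmCollisionKernel ω₀ εF T) F =
      intOp volume (symmKernel 0) F + (T * (2 * εF)⁻¹) • intOp volume (symmKernel 1) F -
        (T ^ 2 * (2 * ω₀ ^ 2)⁻¹) • intOp volume (symmKernel 2) F := by
  funext x
  have hrow (i : ℕ) := (isSchurKernel_symmKernel i).integrable_row_mul hF x
  simp only [intOp, Pi.add_apply, Pi.sub_apply, Pi.smul_apply, smul_eq_mul]
  have hrow₀₁ : Integrable fun y => symmKernel 0 x y * F y +
      T * (2 * εF)⁻¹ * (symmKernel 1 x y * F y) := (hrow 0).add ((hrow 1).const_mul _)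
  rw [← integral_const_mul, ← integral_const_mul, ← integral_add (hrow 0) ((hrow 1).const_mul _),
    ← integral_sub hrow₀₁ ((hrow 2).const_mul _)]
  congr 1
  funext y
  rw [symmCollisionKernel]
  ring

lemma collisionOp_toLp_eq_sourceVec_iff {F : ℝ → ℝ} (hF : MemLp F 2) :
    collisionOp ω₀ εF T hF.toLp = sourceVec ↔
      ∀ᵐ x, F x = source x + intOp volume (symmCollisionKernel ω₀ εF T) F x := by
  have happly (i : ℕ) : symmOp i hF.toLp = ((isSchurKernel_symmKernel i).memLp_intOp hF).toLp :=
    (isSchurKernel_symmKernel i).toCLM_toLp hF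
  rw [collisionOp, perturbedOp_apply, firstOrderOp, secondOrderOp, smul_apply, smul_apply,
    happly, happly, happly, sourceVec, smul_smul, smul_smul, ← MemLp.toLp_const_smul,
    ← MemLp.toLp_const_smul, ← MemLp.toLp_sub, ← MemLp.toLp_sub, ← MemLp.toLp_add,
    MemLp.toLp_eq_toLp_iff, intOp_symmCollisionKernel hF]
  refine eventually_congr (.of_forall fun x => ?_)
  simp only [Pi.add_apply, Pi.sub_apply, Pi.smul_apply]
  constructor <;> intro h <;> linarith

lemma K_mul_eq (hω₀ : ω₀ ≠ 0) (hT : 0 < T) (φ : ℝ → ℝ) (ε u : ℝ) :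
    K ω₀ εF T ε u * φ u = (T * (T ^ 3 / ω₀ ^ 2 * groundState (ε / T)))⁻¹ *
      (symmCollisionKernel ω₀ εF T (ε / T) (u / T) * symmetrize ω₀ T φ (u / T)) := by
  have he := groundState_pos (ε / T)
  rw [K, K₀_eq hω₀ hT, K₁_eq hω₀ hT, K₂_eq hω₀ hT, symmetrize_div hT.ne', symmCollisionKernel]
  field_simp

lemma equation_iff (hω₀ : ω₀ ≠ 0) (hT : 0 < T) (hF : MemLp (symmetrize ω₀ T φ) 2) (ε : ℝ) :
    (Integrable (fun u => K ω₀ εF T ε u * φ u) ∧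
      φ ε = 1 / Γ₀ ω₀ T ε + ∫ u, K ω₀ εF T ε u * φ u) ↔
    symmetrize ω₀ T φ (ε / T) = source (ε / T) +
      intOp volume (symmCollisionKernel ω₀ εF T) (symmetrize ω₀ T φ) (ε / T) := by
  have he := groundState_pos (ε / T)
  have hm := moment_zero_pos (ε / T)
  set d := T ^ 3 / ω₀ ^ 2 * groundState (ε / T) with hd
  have hd₀ : d ≠ 0 := by positivity
  have hK : Integrable fun u => K ω₀ εF T ε u * φ u := by
    simp only [K_mul_eq hω₀ hT]
    exact integrable_const_mul_comp_div hT.ne' (integrable_symmCollisionKernel_mul hF (ε / T)) _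
  have hint : ∫ u, K ω₀ εF T ε u * φ u =
      intOp volume (symmCollisionKernel ω₀ εF T) (symmetrize ω₀ T φ) (ε / T) / d := by
    simp only [K_mul_eq hω₀ hT]
    rw [integral_const_mul_comp_div hT fun y =>
      symmCollisionKernel ω₀ εF T (ε / T) y * symmetrize ω₀ T φ y, ← hd, intOp]
    field_simp
  have hΓ : 1 / Γ₀ ω₀ T ε = source (ε / T) / d := by
    rw [Γ₀_eq hT, source_eq_groundState_div, hd]
    field_simp
  rw [and_iff_right hK, hint, hΓ, ← add_div, eq_div_iff hd₀, symmetrize_div hT.ne', mul_comm]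

lemma isSolution_iff (hω₀ : ω₀ ≠ 0) (hT : 0 < T) : IsSolution ω₀ εF T φ ↔
    ∃ hF : MemLp (symmetrize ω₀ T φ) 2, collisionOp ω₀ εF T hF.toLp = sourceVec := by
  have hequation (hF : MemLp (symmetrize ω₀ T φ) 2) :
      (∀ᵐ ε, Integrable (fun u => K ω₀ εF T ε u * φ u) ∧
        φ ε = 1 / Γ₀ ω₀ T ε + ∫ u, K ω₀ εF T ε u * φ u) ↔
      collisionOp ω₀ εF T hF.toLp = sourceVec := by
    rw [collisionOp_toLp_eq_sourceVec_iff hF, ← ae_comp_div_iff hT.ne' (p := fun x =>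
      symmetrize ω₀ T φ x =
        source x + intOp volume (symmCollisionKernel ω₀ εF T) (symmetrize ω₀ T φ) x)]
    exact eventually_congr (.of_forall fun ε => equation_iff hω₀ hT hF ε)
  constructor
  · intro h
    have hF := (memLp_sigmaMeasure_iff hω₀ hT).1 h.memLp
    exact ⟨hF, (hequation hF).1 h.eqn⟩
  · rintro ⟨hF, h⟩
    exact ⟨(memLp_sigmaMeasure_iff hω₀ hT).2 hF, (hequation hF).2 h⟩

lemma w_mul_eq (hω₀ : ω₀ ≠ 0) (hT : 0 < T) (φ : ℝ → ℝ) (ε : ℝ) :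
    w T ε * φ ε = ω₀ ^ 2 / T ^ 3 * (source (ε / T) * symmetrize ω₀ T φ (ε / T)) := by
  rw [w_eq_groundState_mul_source, symmetrize_div hT.ne']
  field_simp

lemma integrable_w_mul (hω₀ : ω₀ ≠ 0) (hT : 0 < T) (hF : MemLp (symmetrize ω₀ T φ) 2) :
    Integrable fun ε => w T ε * φ ε := by
  simp only [w_mul_eq hω₀ hT φ]
  exact integrable_const_mul_comp_div hT.ne' (memLp_source.integrable_mul hF) _

lemma relaxationTime_eq (hω₀ : ω₀ ≠ 0) (hT : 0 < T) (hF : MemLp (symmetrize ω₀ T φ) 2) :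
    relaxationTime T φ = ω₀ ^ 2 / (2 * T ^ 3) * ⟪sourceVec, hF.toLp⟫ := by
  rw [relaxationTime]
  simp only [w_mul_eq hω₀ hT φ]
  rw [integral_const_mul_comp_div hT fun x => source x * symmetrize ω₀ T φ x, sourceVec,
    inner_toLp_toLp]
  field_simp

lemma exists_unique_isSolution (hω₀ : ω₀ ≠ 0) (hT : 0 < T)
    (hbij : Function.Bijective (collisionOp ω₀ εF T)) :
    ∃ φ, IsSolution ω₀ εF T φ ∧ Integrable (fun ε => w T ε * φ ε) ∧
      ∀ ψ, IsSolution ω₀ εF T ψ → ψ =ᵐ[volume] φ := by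
  obtain ⟨F, hF⟩ := hbij.surjective sourceVec
  set φ := unsymmetrize ω₀ T F
  have hsymm : symmetrize ω₀ T φ = F := symmetrize_unsymmetrize hω₀ hT.ne' F
  have hmem : MemLp (symmetrize ω₀ T φ) 2 := by
    rw [hsymm]
    exact Lp.memLp F
  have htoLp : hmem.toLp = F := by
    simp only [hsymm]
    exact Lp.toLp_coeFn F _
  have hφ : collisionOp ω₀ εF T hmem.toLp = sourceVec := by rw [htoLp, hF]
  refine ⟨φ, (isSolution_iff hω₀ hT).2 ⟨hmem, hφ⟩, integrable_w_mul hω₀ hT hmem, fun ψ hψ => ?_⟩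
  obtain ⟨hψmem, hψ⟩ := (isSolution_iff hω₀ hT).1 hψ
  have heq := hbij.injective (hψ.trans hφ.symm)
  exact ae_eq_of_symmetrize_ae_eq hω₀ hT.ne' ((MemLp.toLp_eq_toLp_iff _ _).1 heq)

lemma eventually_bijective_collisionOp (hω₀ : ω₀ ≠ 0) (εF : ℝ) :
    ∀ᶠ T in 𝓝[>] 0, Function.Bijective (collisionOp ω₀ εF T) := by
  obtain ⟨q, h⟩ := exists_isGappedPerturbation hω₀ εF
  exact h.eventually_bijective.filter_mono (nhdsWithin_mono 0 fun T hT => ne_of_gt hT)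

theorem tendsto_pow_mul_relaxationTime (hω₀ : ω₀ ≠ 0) {φ : ℝ → ℝ → ℝ}
    (hφ : ∀ᶠ T in 𝓝[>] 0, IsSolution ω₀ εF T (φ T)) :
    Tendsto (fun T => T ^ 5 * relaxationTime T (φ T)) (𝓝[>] 0)
      (𝓝 (ω₀ ^ 2 / rateCoeff ω₀ εF / 2)) := by
  obtain ⟨q, hgap⟩ := exists_isGappedPerturbation hω₀ εF
  have hvec : ∀ᶠ T in 𝓝[>] 0, ∃ F, collisionOp ω₀ εF T F = sourceVec ∧
      relaxationTime T (φ T) = ω₀ ^ 2 / (2 * T ^ 3) * ⟪sourceVec, F⟫ := by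
    filter_upwards [hφ, self_mem_nhdsWithin] with T h hT
    obtain ⟨hF, hcoll⟩ := (isSolution_iff hω₀ hT).1 h
    exact ⟨hF.toLp, hcoll, relaxationTime_eq hω₀ hT hF⟩
  obtain ⟨F, hF⟩ := hvec.choice
  have hlim := hgap.tendsto_sq_mul_inner inner_groundVec_sourceVec nhdsWithin_le_nhds
    (hF.mono fun T h => h.1)
  rw [show ω₀ ^ 2 / rateCoeff ω₀ εF / 2 = ω₀ ^ 2 / 2 * (rateCoeff ω₀ εF)⁻¹ by ring]
  refine (hlim.const_mul (ω₀ ^ 2 / 2)).congr' ?_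
  filter_upwards [hF, self_mem_nhdsWithin] with T h (hT : 0 < T)
  rw [h.2]
  field_simp

end Bloch

theorem theorem3p1 (ω₀ εF : ℝ) (hω₀ : 0 < ω₀) (hεF : 0 < εF) :
    -- all integrals and the series that define `φ₊` converge, and `1/φ₊` is positive
    (∀ T : ℝ, 0 < T →
      (∀ ε, Integrable (Bloch.Kbar₀ ω₀ T ε) ∧ Integrable (Bloch.Kbar₁ ω₀ εF T ε) ∧
        Integrable (Bloch.Kbar₂ ω₀ T ε) ∧ 0 < Bloch.Γ₀ ω₀ T ε) ∧
      (∀ (m : ℕ) (ε : ℝ),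
        Integrable (fun u => Bloch.K₀ ω₀ T ε u * Bloch.iter ω₀ εF T m u)) ∧
      Integrable (fun ε => Bloch.Γ₂ ω₀ T ε * Bloch.w T ε) ∧
      (∀ m : ℕ, Integrable (fun ε => Bloch.term ω₀ εF T m ε * Bloch.w T ε)) ∧
      Summable (fun m : ℕ => Bloch.avg T (Bloch.term ω₀ εF T m)) ∧
      0 < Bloch.rate ω₀ εF T) ∧
    -- at low temperature the integral equation has exactly one solution,
    -- and its energy average converges
    (∃ T₀ : ℝ, 0 < T₀ ∧ ∀ T : ℝ, 0 < T → T < T₀ →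
      ∃ φ : ℝ → ℝ, Bloch.IsSolution ω₀ εF T φ ∧
        Integrable (fun ε => Bloch.w T ε * φ ε) ∧
        ∀ ψ : ℝ → ℝ, Bloch.IsSolution ω₀ εF T ψ → ψ =ᵐ[volume] φ) ∧
    -- leading behaviour of the relaxation time and Bloch's law
    (∃ C : ℝ, 0 < C ∧ (∀ T : ℝ, 0 < T → Bloch.phiPlus ω₀ εF T = C / T ^ 5) ∧
      ∀ φ : ℝ → ℝ → ℝ, (∀ᶠ T in 𝓝[>] (0 : ℝ), Bloch.IsSolution ω₀ εF T (φ T)) →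
        ((fun T => Bloch.relaxationTime T (φ T)) ~[𝓝[>] (0 : ℝ)]
          (fun T => Bloch.phiPlus ω₀ εF T / 2)) ∧
        Tendsto (fun T => T ^ 5 * Bloch.relaxationTime T (φ T)) (𝓝[>] (0 : ℝ))
          (𝓝 (C / 2))) := by
  have hω := hω₀.ne'
  have hκ := Bloch.rateCoeff_pos hω εF
  refine ⟨fun T hT => ?_, ?_, ω₀ ^ 2 / Bloch.rateCoeff ω₀ εF, by positivity,
    fun T hT => Bloch.phiPlus_eq hω hT, fun φ hφ => ?_⟩
  · exact ⟨fun ε => ⟨Bloch.integrable_Kbar₀ hT.ne' ε, Bloch.integrable_Kbar₁ hω hT.ne' ε,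
      Bloch.integrable_Kbar₂ hT.ne' ε, Bloch.Γ₀_pos hω hT ε⟩, Bloch.integrable_K₀_mul_iter hω hT,
      Bloch.integrable_Γ₂_mul_w hT, Bloch.integrable_term_mul_w hω hT,
      Bloch.summable_avg_term hω hT, Bloch.rate_pos hω hT⟩
  · obtain ⟨T₀, hT₀, hbij⟩ := mem_nhdsGT_iff_exists_Ioo_subset.1
      (Bloch.eventually_bijective_collisionOp hω εF)
    exact ⟨T₀, hT₀, fun T hT hTT₀ => Bloch.exists_unique_isSolution hω hT (hbij ⟨hT, hTT₀⟩)⟩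
  · have hlim := Bloch.tendsto_pow_mul_relaxationTime hω hφ
    refine ⟨(isEquivalent_const_div_pow_of_tendsto (by positivity) hlim).congr_right ?_, hlim⟩
    filter_upwards [self_mem_nhdsWithin] with T hT
    rw [Bloch.phiPlus_eq hω hT]
    ring
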